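/- **Setting.** Let $\Theta$ be a finite set and let $k(x\mid\theta)$, $x\in\mathbb R$, $\theta\in\Theta$, be strictly positive probability densities on $\mathbb R$ (with respect to Lebesgue measure), bounded uniformly in $(x,\theta)$, continuously differentiable in $x$ with $\sup_{\theta,x}|k'(x\mid\theta)|<\infty$, and such that $\sum_\theta k(\cdot\mid\theta)g(\theta)$ identifies the probability mass function $g$ on $\Theta$. Let $f_Z$ be a strictly positive, bounded, uniformly continuous probability density on $\mathbb R$, and put $\tilde k(\cdot\mid\theta)=f_Z*k(\cdot\mid\theta)$. Let $\tilde g_0$ be a probability mass function on $\Theta$ with $\tilde g_0(\theta)>0$ for all $\theta$, and let $(\tilde\alpha_n)_{n\ge1}$ be numbers in $(0,1)$ with $\sum_n\tilde\alpha_n=\infty$ and $\sum_n\tilde\alpha_n^2<\infty$. For real random variables $(Y_n)_{n\ge1}$ on a probability space $(\Omega,\mathcal F,P)$ define, for $n\ge0$, $$\tilde g_{n+1}(\theta)=(1-\tilde\alpha_{n+1})\tilde g_n(\theta)+\tilde\alpha_{n+1}\,\tilde g_n(\theta\mid Y_{n+1}),\qquad \tilde g_n(\theta\mid y)=\frac{\tilde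 k(y\mid\theta)\tilde g_n(\theta)}{\sum_{\theta'}\tilde k(y\mid\theta')\tilde g_n(\theta')},$$ and suppose that for every $n\ge0$ the conditional distribution of $Y_{n+1}$ given $\mathcal G_n=\sigma(Y_1,\dots,Y_n)$ has the density $f^{(Y)}_n(y)=\sum_\theta\tilde k(y\mid\theta)\tilde g_n(\theta)$. Let $f_n^{(X)}(x)=\sum_\theta k(x\mid\theta)\tilde g_n(\theta)$. **Theorem.** There is a random probability mass function $\tilde g$ on $\Theta$ with $\sup_\theta|\tilde g_n(\theta)-\tilde g(\theta)|\to0$ $P$-almost surely. For any such $\tilde g$ put $f^{(X)}(x)=\sum_\theta k(x\mid\theta)\tilde g(\theta)$, $f^{(Y)}(y)=\sum_\theta\tilde k(y\mid\theta)\tilde g(\theta)$, $\tilde g(\theta\mid y)=\tilde k(y\mid\theta)\tilde g(\theta)/f^{(Y)}(y)$, $f^{(X)}(x\mid y)=\sum_\theta k(x\mid\theta)\tilde g(\theta\mid y)$ and $$v(x)=\int_{\mathbb R}\bigl(f^{(X)}(x\mid y)-f^{(X)}(x)\bigr)^2f^{(Y)}(y)\,dy .$$ Let $x\in\mathbb R$.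 If $(b_n)_{n\ge1}$ is a nondecreasing sequence of strictly positive numbers with $$b_n\uparrow+\infty,\qquad \sum_{n\ge1}\tilde\alpha_n^4b_n^2<\infty,\qquad b_n\sup_{k\ge n}\tilde\alpha_k^2\to0,\qquad b_n\sum_{k\ge n}\tilde\alpha_k^2\to1,$$ then $b_n^{1/2}\bigl(f_n^{(X)}(x)-f^{(X)}(x)\bigr)$ converges, in the sense of almost-sure conditional convergence, to the centered Gaussian kernel $\mathcal N(0,v(x))$ with random variance $v(x)$; that is, for $P$-almost every $\omega$, the regular conditional distribution of $b_n^{1/2}(f_n^{(X)}(x)-f^{(X)}(x))$ given $\mathcal G_n$, evaluated at $\omega$, converges weakly to $\mathcal N(0,v(x)(\omega))$ as $n\to\infty$ (with $\mathcal N(0,0)$ the point mass at $0$). If $\tilde\alpha_n=\bigl(\frac{\alpha}{\alpha+n}\bigr)^\gamma$ for all $n\ge1$, with $\alpha>0$ and $\gamma\in(1/2,1]$, then the convergence holds with $b_n=\frac{2\gamma-1}{\alpha^{2\gamma}}n^{2\gamma-1}$. -/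

import Mathlib

open MeasureTheory ProbabilityTheory Filter Topology
open scoped Convolution

namespace NewtonDeconvolution

noncomputable section

/-! ### Mixtures and Newton's recursion

`Θ` is a finite set carrying the counting measure, so integrals over `Θ` are finite sums.
A kernel `k(x ∣ θ)` is written `k θ x`. -/

/-- The mixture `x ↦ ∫ k(x ∣ θ) g(θ) μ(dθ)`, with `μ` the counting measure on `Θ`. -/
def mixture {Θ : Type*} [Fintype Θ] (k : Θ → ℝ → ℝ) (g : Θ → ℝ) (x : ℝ) : ℝ :=
  ∑ θ, k θ x * g θ

/-- The noisy kernel `k̃(y ∣ θ) = (f_Z ∗ k(· ∣ θ))(y) = ∫ f_Z(t) k(y - t ∣ θ) dt`. -/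
def noisyKernel {Θ : Type*} (k : Θ → ℝ → ℝ) (fZ : ℝ → ℝ) (θ : Θ) (y : ℝ) : ℝ :=
  (fZ ⋆[ContinuousLinearMap.mul ℝ ℝ, volume] k θ) y

/-- The updated mass function `g(θ ∣ y) = k̃(y ∣ θ) g(θ) / ∫ k̃(y ∣ θ') g(θ') μ(dθ')`,
where `kt` stands for `k̃`. -/
def posterior {Θ : Type*} [Fintype Θ] (kt : Θ → ℝ → ℝ) (g : Θ → ℝ) (y : ℝ) (θ : Θ) : ℝ :=
  kt θ y * g θ / mixture kt g y

/-- Newton's algorithm: `g̃_0 = g0` and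
`g̃_{n+1}(θ) = (1 - α_{n+1}) g̃_n(θ) + α_{n+1} g̃_n(θ ∣ Y_{n+1})`.
The observations are `Y 1, Y 2, …`; `Y 0` and `α 0` are never used. -/
def newton {Θ Ω : Type*} [Fintype Θ] (kt : Θ → ℝ → ℝ) (α : ℕ → ℝ) (g0 : Θ → ℝ)
    (Y : ℕ → Ω → ℝ) : ℕ → Ω → Θ → ℝ
  | 0, _, θ => g0 θ
  | n + 1, ω, θ =>
      (1 - α (n + 1)) * newton kt α g0 Y n ω θ
        + α (n + 1) * posterior kt (newton kt α g0 Y n ω) (Y (n + 1) ω) θ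

/-- The sigma-algebra `𝒢_n` generated by `Y_1, …, Y_n` (trivial for `n = 0`). -/
abbrev obsSigma {Ω : Type*} (Y : ℕ → Ω → ℝ) (n : ℕ) : MeasurableSpace Ω :=
  ⨆ i ∈ Finset.Icc 1 n, MeasurableSpace.comap (Y i) inferInstance

/-! ### Standing assumptions -/

/-- The assumptions on the initial guess `g0`, the kernel `k` and the noise density `fZ`
(all densities are with respect to Lebesgue measure on `ℝ`). -/
structure ModelAssumptions {Θ : Type*} [Fintype Θ] (k : Θ → ℝ → ℝ) (fZ : ℝ → ℝ)
    (g0 : Θ → ℝ) : Prop where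
  /-- the initial guess is a strictly positive probability mass function -/
  g0_pos : ∀ θ, 0 < g0 θ
  g0_sum : ∑ θ, g0 θ = 1
  /-- `k(· ∣ θ)` is a strictly positive probability density -/
  k_pos : ∀ θ x, 0 < k θ x
  k_integral : ∀ θ, ∫ x, k θ x = 1
  k_bounded : ∃ C, ∀ θ x, k θ x ≤ C
  k_contDiff : ∀ θ, ContDiff ℝ 1 (k θ)
  k_deriv_bounded : ∃ C, ∀ θ x, |deriv (k θ) x| ≤ C
  /-- the mixture identifies the mixing probability mass function -/
  k_identifies : ∀ g ∈ stdSimplex ℝ Θ, ∀ g' ∈ stdSimplex ℝ Θ,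
    (∀ x, mixture k g x = mixture k g' x) → g = g'
  /-- `fZ` is a strictly positive, bounded, uniformly continuous probability density -/
  fZ_pos : ∀ z, 0 < fZ z
  fZ_integral : ∫ z, fZ z = 1
  fZ_bounded : ∃ C, ∀ z, fZ z ≤ C
  fZ_uniformContinuous : UniformContinuous fZ

/-- The learning rate `(α_n)_{n ≥ 1}`: numbers in `(0,1)` with `∑ α_n = ∞`, `∑ α_n² < ∞`. -/
structure LearningRate (α : ℕ → ℝ) : Prop where
  pos : ∀ n, 1 ≤ n → 0 < α n
  lt_one : ∀ n, 1 ≤ n → α n < 1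
  sum_diverges : ¬ Summable α
  sq_summable : Summable fun n => α n ^ 2

/-- `(Y_n)_{n ≥ 1}` follows the learning procedure: conditionally on `𝒢_n`, the variable `Y_{n+1}`
has density `f_n^{(Y)}(y) = ∫ k̃(y ∣ θ) g̃_n(θ) μ(dθ)`, for every `n ≥ 0`. -/
structure IsLearningProcess {Θ Ω : Type*} [Fintype Θ] [MeasurableSpace Ω] (P : Measure Ω)
    (k : Θ → ℝ → ℝ) (fZ : ℝ → ℝ) (g0 : Θ → ℝ) (α : ℕ → ℝ) (Y : ℕ → Ω → ℝ) : Prop where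
  measurable : ∀ n, 1 ≤ n → Measurable (Y n)
  condDensity : ∀ n, ∀ B : Set ℝ, MeasurableSet B →
    P⟦Y (n + 1) ⁻¹' B | obsSigma Y n⟧ =ᵐ[P] fun ω =>
      ∫ y in B, mixture (noisyKernel k fZ) (newton (noisyKernel k fZ) α g0 Y n ω) y

/-! ### Limits -/

/-- `g` is (a version of) the almost sure limit of the sequence `gn` of random probability mass
functions: a random probability mass function with `sup_θ |gn n θ - g θ| → 0` almost surely
(the topology of `Θ → ℝ`, with `Θ` finite, is that of the supremum norm). -/
structure IsLimitMixing {Θ Ω : Type*} [Fintype Θ] [MeasurableSpace Ω] (P : Measure Ω)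
    (gn : ℕ → Ω → Θ → ℝ) (g : Ω → Θ → ℝ) : Prop where
  measurable : Measurable g
  mem_simplex : ∀ ω, g ω ∈ stdSimplex ℝ Θ
  tendsto : ∀ᵐ ω ∂P, Tendsto (fun n => gn n ω) atTop (𝓝 (g ω))

/-- The conditional density `f^{(X)}(x ∣ y) = ∫ k(x ∣ θ) g(θ ∣ y) μ(dθ)`. -/
def condMixture {Θ : Type*} [Fintype Θ] (k : Θ → ℝ → ℝ) (fZ : ℝ → ℝ) (g : Θ → ℝ)
    (x y : ℝ) : ℝ :=
  mixture k (posterior (noisyKernel k fZ) g y) x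

/-- `v(x) = ∫ (f^{(X)}(x ∣ y) - f^{(X)}(x))² f^{(Y)}(y) dy`, computed from the mixing `g`. -/
def asympVariance {Θ : Type*} [Fintype Θ] (k : Θ → ℝ → ℝ) (fZ : ℝ → ℝ) (g : Θ → ℝ)
    (x : ℝ) : ℝ :=
  ∫ y, (condMixture k fZ g x y - mixture k g x) ^ 2 * mixture (noisyKernel k fZ) g y

/-- The conditions on the normalising sequence `(b_n)_{n ≥ 1}` of strictly positive numbers:
`b_n ↑ ∞`, `∑ α_n⁴ b_n² < ∞`, `b_n sup_{k ≥ n} α_k² → 0`, `b_n ∑_{k ≥ n} α_k² → 1`. -/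
structure NormalisingSequence (α b : ℕ → ℝ) : Prop where
  pos : ∀ n, 1 ≤ n → 0 < b n
  mono : ∀ m n, 1 ≤ m → m ≤ n → b m ≤ b n
  tendsto_top : Tendsto b atTop atTop
  summable : Summable fun n => α n ^ 4 * b n ^ 2
  sup_tendsto : Tendsto (fun n => b n * ⨆ j : ℕ, α (n + j) ^ 2) atTop (𝓝 0)
  tail_tendsto : Tendsto (fun n => b n * ∑' j : ℕ, α (n + j) ^ 2) atTop (𝓝 1)

/-! ### Almost-sure conditional convergence -/

/-- `κ` is a regular version of the conditional distribution of `X` given the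
sub-sigma-algebra `m`. -/
structure IsRegularCondDistrib {Ω : Type*} [MeasurableSpace Ω] (P : Measure Ω)
    (m : MeasurableSpace Ω) (X : Ω → ℝ) (κ : Ω → ProbabilityMeasure ℝ) : Prop where
  measurable : Measurable[m] fun ω => (κ ω : Measure ℝ)
  condProb : ∀ B : Set ℝ, MeasurableSet B →
    P⟦X ⁻¹' B | m⟧ =ᵐ[P] fun ω => (κ ω : Measure ℝ).real B

/-- Almost-sure conditional convergence of `(X_n)` to the kernel `K`, with respect to the
sigma-algebras `(G n)`: the regular conditional distributions of `X_n` given `G n` exist and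
converge weakly to `K ω`, for almost every `ω`. (Regular versions on `ℝ` are almost surely
unique, so the choice of the versions does not matter.) -/
def AlmostSureCondConvergence {Ω : Type*} [MeasurableSpace Ω] (P : Measure Ω)
    (G : ℕ → MeasurableSpace Ω) (X : ℕ → Ω → ℝ) (K : Ω → ProbabilityMeasure ℝ) : Prop :=
  (Measurable fun ω => (K ω : Measure ℝ)) ∧
    ∃ κ : ℕ → Ω → ProbabilityMeasure ℝ,
      (∀ n, IsRegularCondDistrib P (G n) (X n) (κ n)) ∧
        ∀ᵐ ω ∂P, Tendsto (fun n => κ n ω) atTop (𝓝 (K ω))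

/-- The centered Gaussian kernel `𝒩(0, v)` with random variance `v ≥ 0`, where `𝒩(0, 0)` is the
point mass at `0`. -/
def centeredGaussianKernel {Ω : Type*} (v : Ω → ℝ) (ω : Ω) : ProbabilityMeasure ℝ :=
  ⟨gaussianReal 0 (v ω).toNNReal, inferInstance⟩

/-- The local central limit theorem at `x` with normalising sequence `b`: given `𝒢_n`,
`b_n^{1/2} (f_n^{(X)}(x) - f^{(X)}(x))` converges, in the sense of almost-sure conditional
convergence, to the Gaussian kernel `𝒩(0, v(x))`. Here `g` is the limit of `g̃_n`. -/
def LocalCLT {Θ Ω : Type*} [Fintype Θ] [MeasurableSpace Ω] (P : Measure Ω)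
    (k : Θ → ℝ → ℝ) (fZ : ℝ → ℝ) (g0 : Θ → ℝ) (α : ℕ → ℝ) (Y : ℕ → Ω → ℝ)
    (g : Ω → Θ → ℝ) (b : ℕ → ℝ) (x : ℝ) : Prop :=
  AlmostSureCondConvergence P (obsSigma Y)
    (fun n ω => √(b n) *
      (mixture k (newton (noisyKernel k fZ) α g0 Y n ω) x - mixture k (g ω) x))
    (centeredGaussianKernel fun ω => asympVariance k fZ (g ω) x)

end

end NewtonDeconvolution

open NewtonDeconvolution

/-! Averaging the posterior against the predictive density returns the prior, so every coordinate of
`g̃_n` is a bounded martingale and converges almost surely. By linearity `M_n = f_n^{(X)}(x)` is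
also a bounded martingale. Its increments are `α_{n+1} D_n`, with `D_n` bounded, conditionally
centred, and of conditional variance `v_n`, the functional `asympVariance` at `g̃_n`. Dominated
convergence gives `v_n → v(x)`. What remains is a central limit theorem for the tail `M_n - M_∞`,
conditionally on `𝒢_n`.

Fix `t` and put `c = t √(b_n)`. The product of `exp(i c (M_n - M_{n+i}))` and `exp(c²/2 ∑ α² v)` is
nearly a martingale in `i`: the Taylor terms up to second order cancel, and the cubic errors sum to
at most a largest term times a sum of squares, which tends to 0 under the conditions on `b_n`. Hence
its limit has conditional expectation `1 + o(1)` given `𝒢_n` (`norm_condExp_expLimit_sub_one_le`).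
The normalisation `V_n = b_n ∑ α² v` depends on the future, but `V_n` and `v_n` have the same almost
sure limit. So `v_n`, which is known at time `n`, may replace `V_n`, at a cost controlled by Hunt's
lemma (`tendsto_condExp_zero_of_bounded`). This yields the limit `exp(-t² v(x)/2)` of the
conditional characteristic functions (`ae_tendsto_condExp_cexp`).

The exceptional null set depends on `t`. Only rational `t` are therefore used, and conditional
second moment bounds extend the convergence to all `t` (`tendsto_of_tendsto_charFun_rat`). For power
rates, the two conditions on `b_n` follow by comparing tail sums with telescoping series. -/

namespace NewtonDeconvolution

/-! ### Conditional expectations of bounded convergent sequences -/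

/-- Conditional expectation is an `L¹` contraction, so bounded convergence gives convergence in
`L¹`, hence in measure, hence almost everywhere along a subsequence. That is enough to pass a bound
valid for every index to the limit. -/
theorem exists_subseq_tendsto_condExp {Ω E : Type*} {m m0 : MeasurableSpace Ω} {P : Measure Ω}
    [IsFiniteMeasure P] [NormedAddCommGroup E] [NormedSpace ℝ E] [CompleteSpace E]
    {f : ℕ → Ω → E} {g : Ω → E} {B : ℝ} (hf : ∀ n, AEStronglyMeasurable (f n) P)
    (hB : ∀ n, ∀ᵐ ω ∂P, ‖f n ω‖ ≤ B)
    (hlim : ∀ᵐ ω ∂P, Tendsto (fun n => f n ω) atTop (𝓝 (g ω))) :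
    ∃ ns : ℕ → ℕ, StrictMono ns ∧
      ∀ᵐ ω ∂P, Tendsto (fun i => (P[f (ns i) | m]) ω) atTop (𝓝 ((P[g | m]) ω)) := by
  have hg : AEStronglyMeasurable g P := aestronglyMeasurable_of_tendsto_ae _ hf hlim
  have hfi : ∀ n, Integrable (f n) P := fun n => Integrable.of_bound (hf n) B (hB n)
  have hgB : ∀ᵐ ω ∂P, ‖g ω‖ ≤ B := by
    filter_upwards [ae_all_iff.2 hB, hlim] with ω h1 h2
    exact le_of_tendsto h2.norm (Eventually.of_forall h1)
  have hgi : Integrable g P := Integrable.of_bound hg B hgB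
  have hL1 : Tendsto (fun n => eLpNorm (f n - g) 1 P) atTop (𝓝 0) := by
    simp_rw [eLpNorm_one_eq_lintegral_enorm, Pi.sub_apply]
    have := tendsto_lintegral_norm_of_dominated_convergence (bound := fun _ => B) hf
      (hasFiniteIntegral_const B) hB hlim
    simpa [ofReal_norm] using this
  refine (tendstoInMeasure_of_tendsto_eLpNorm (p := 1) one_ne_zero
    (fun n => integrable_condExp.1) integrable_condExp.1 ?_).exists_seq_tendsto_ae
  refine tendsto_of_tendsto_of_tendsto_of_le_of_le tendsto_const_nhds hL1
    (fun _ => bot_le) (fun n => ?_)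
  calc eLpNorm (P[f n | m] - P[g | m]) 1 P = eLpNorm (P[f n - g | m]) 1 P :=
        eLpNorm_congr_ae (condExp_sub (hfi n) hgi m).symm
    _ ≤ _ := eLpNorm_condExp_le_eLpNorm _ le_rfl

/-- Hunt's lemma for a bounded sequence of nonnegative random variables tending to zero. -/
theorem tendsto_condExp_zero_of_bounded {Ω : Type*} {m0 : MeasurableSpace Ω} {P : Measure Ω}
    [IsFiniteMeasure P] (ℱ : Filtration ℕ m0) {W : ℕ → Ω → ℝ} {B : ℝ}
    (hm : ∀ n, AEMeasurable (W n) P) (h0 : ∀ n ω, 0 ≤ W n ω) (hB : ∀ n ω, W n ω ≤ B)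
    (hlim : ∀ᵐ ω ∂P, Tendsto (fun n => W n ω) atTop (𝓝 0)) :
    ∀ᵐ ω ∂P, Tendsto (fun n => (P[W n | ℱ n]) ω) atTop (𝓝 0) := by
  -- For `k ≥ n`, `W k ≤ S n`, so `E[W k | ℱ k] ≤ E[S n | ℱ k]`, which by Lévy's upward theorem
  -- tends to `E[S n | ⨆ ℱ]` as `k → ∞`. The latter decreases in `n` and its integrals tend to 0, so
  -- it tends to 0 almost everywhere.
  set S : ℕ → Ω → ℝ := fun n ω => ⨆ j, W (n + j) ω with hS
  have hbdd : ∀ n ω, BddAbove (Set.range fun j => W (n + j) ω) := fun n ω =>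
    ⟨B, by rintro _ ⟨j, rfl⟩; exact hB _ _⟩
  have hWS : ∀ n k ω, n ≤ k → W k ω ≤ S n ω := by
    intro n k ω hk
    obtain ⟨j, rfl⟩ := Nat.exists_eq_add_of_le hk
    exact le_ciSup (hbdd n ω) j
  have hS0 : ∀ n ω, 0 ≤ S n ω := fun n ω => (h0 n ω).trans (hWS n n ω le_rfl)
  have hSB : ∀ n ω, S n ω ≤ B := fun n ω => ciSup_le fun j => hB _ _
  have hSm : ∀ n, AEMeasurable (S n) P := fun n => AEMeasurable.iSup fun j => hm _
  have hSi : ∀ n, Integrable (S n) P := fun n =>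
    Integrable.of_bound (hSm n).aestronglyMeasurable B
      (ae_of_all _ fun ω => by rw [Real.norm_eq_abs, abs_of_nonneg (hS0 n ω)]; exact hSB n ω)
  have hWi : ∀ n, Integrable (W n) P := fun n =>
    Integrable.of_bound (hm n).aestronglyMeasurable B
      (ae_of_all _ fun ω => by rw [Real.norm_eq_abs, abs_of_nonneg (h0 n ω)]; exact hB n ω)
  have hSanti : ∀ n, ∀ ω, S (n + 1) ω ≤ S n ω := fun n ω =>
    ciSup_le fun j => hWS _ _ _ (by omega)
  have hSlim : ∀ᵐ ω ∂P, Tendsto (fun n => S n ω) atTop (𝓝 0) := by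
    filter_upwards [hlim] with ω hω
    rw [Metric.tendsto_atTop] at hω ⊢
    intro ε hε
    obtain ⟨N, hN⟩ := hω (ε / 2) (by positivity)
    refine ⟨N, fun n hn => ?_⟩
    have : S n ω ≤ ε / 2 := ciSup_le fun j => by
      have := hN (n + j) (by omega)
      rw [Real.dist_eq, sub_zero] at this
      exact (le_abs_self _).trans this.le
    rw [Real.dist_eq, sub_zero, abs_of_nonneg (hS0 n ω)]
    linarith
  have hint : Tendsto (fun n => ∫ ω, S n ω ∂P) atTop (𝓝 0) := by
    have := tendsto_integral_of_dominated_convergence (fun _ => B)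
      (fun n => (hSm n).aestronglyMeasurable) (integrable_const B)
      (fun n => ae_of_all _ fun ω => by
        rw [Real.norm_eq_abs, abs_of_nonneg (hS0 n ω)]; exact hSB n ω) hSlim
    simpa using this
  have hle : (⨆ n, ℱ n : MeasurableSpace Ω) ≤ m0 := iSup_le fun n => ℱ.le n
  have hY : ∀ᵐ ω ∂P, Tendsto (fun n => (P[S n | ⨆ n, ℱ n]) ω) atTop (𝓝 0) := by
    refine tendsto_of_integral_tendsto_of_antitone (F := fun _ => 0)
      (fun n => integrable_condExp) (integrable_zero _ _ _) ?_ ?_ ?_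
    · simpa [integral_condExp hle] using hint
    · have : ∀ n, P[S (n + 1) | ⨆ n, ℱ n] ≤ᵐ[P] P[S n | ⨆ n, ℱ n] := fun n =>
        condExp_mono (hSi _) (hSi _) (ae_of_all _ (hSanti n))
      filter_upwards [ae_all_iff.2 this] with ω hω
      exact antitone_nat_of_succ_le hω
    · refine ae_all_iff.2 fun n => ?_
      exact condExp_nonneg (ae_of_all _ (hS0 n))
  have hcw : ∀ᵐ ω ∂P, ∀ n k, n ≤ k → (P[W k | ℱ k]) ω ≤ (P[S n | ℱ k]) ω := by
    refine ae_all_iff.2 fun n => ae_all_iff.2 fun k => ?_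
    by_cases hk : n ≤ k
    · filter_upwards [condExp_mono (m := ℱ k) (hWi k) (hSi n)
        (ae_of_all P fun ω => hWS n k ω hk)] with ω hω _ using hω
    · exact ae_of_all _ fun ω h => absurd h hk
  have hc0 : ∀ᵐ ω ∂P, ∀ k, 0 ≤ (P[W k | ℱ k]) ω :=
    ae_all_iff.2 fun k => condExp_nonneg (ae_of_all _ (h0 k))
  have hlevy : ∀ᵐ ω ∂P, ∀ n, Tendsto (fun k => (P[S n | ℱ k]) ω) atTop
      (𝓝 ((P[S n | ⨆ n, ℱ n]) ω)) := ae_all_iff.2 fun n => tendsto_ae_condExp (S n)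
  filter_upwards [hY, hcw, hc0, hlevy] with ω h1 h2 h3 h4
  rw [Metric.tendsto_atTop]
  intro ε hε
  obtain ⟨n, hn⟩ := (h1.eventually (gt_mem_nhds hε)).exists
  obtain ⟨N, hN⟩ := eventually_atTop.1 ((h4 n).eventually (gt_mem_nhds hn))
  refine ⟨max n N, fun k hk => ?_⟩
  rw [Real.dist_eq, sub_zero, abs_of_nonneg (h3 k)]
  exact (h2 n k (le_of_max_le_left hk)).trans_lt (hN k (le_of_max_le_right hk))

/-! ### The one-step characteristic function estimate -/

theorem norm_cexp_mul_I_sub_taylor_le {y : ℝ} (hy : |y| ≤ 1) :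
    ‖Complex.exp (y * Complex.I) - (1 + y * Complex.I - (y : ℂ) ^ 2 / 2)‖ ≤ 3 * |y| ^ 3 := by
  have h := Complex.norm_exp_sub_sum_le_norm_mul_exp (y * Complex.I) 3
  have hn : ‖(y * Complex.I : ℂ)‖ = |y| := by simp
  rw [hn] at h
  have hs : ∑ m ∈ Finset.range 3, (y * Complex.I : ℂ) ^ m / (m.factorial : ℂ)
      = 1 + y * Complex.I - (y : ℂ) ^ 2 / 2 := by
    simp [Finset.sum_range_succ, Nat.factorial, mul_pow, Complex.I_sq]
    ring
  rw [hs] at h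
  refine h.trans ?_
  have : Real.exp |y| ≤ 3 := (Real.exp_le_exp.2 hy).trans (by linarith [Real.exp_one_lt_d9])
  nlinarith [pow_nonneg (abs_nonneg y) 3]

/-- The first-order terms of `1 - u` and `exp u` cancel; this is why multiplying by `exp (s² v / 2)`
normalises a characteristic function up to higher order. -/
theorem abs_one_sub_mul_exp_sub_one_le {u : ℝ} (h0 : 0 ≤ u) (h1 : u ≤ 1) :
    |(1 - u) * Real.exp u - 1| ≤ 3 * u ^ 2 := by
  have he : Real.exp u ≤ 3 := (Real.exp_le_exp.2 h1).trans (by linarith [Real.exp_one_lt_d9])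
  have ha := Real.add_one_le_exp (-u)
  have hb := Real.add_one_le_exp u
  have hp := Real.exp_pos u
  have hm : Real.exp (-u) * Real.exp u = 1 := by rw [← Real.exp_add]; simp
  rw [abs_le]
  constructor
  · nlinarith [mul_nonneg h0 h0]
  · nlinarith [mul_nonneg h0 h0]

/-- Conditioning the second-order Taylor expansion removes the linear term and turns the quadratic
one into `u = s² v / 2`, so the conditional characteristic function is `1 - u` up to a cubic error.
-/
theorem norm_condExp_cexp_mul_sub_one_le {Ω : Type*} {m m0 : MeasurableSpace Ω} {P : Measure Ω}
    [IsProbabilityMeasure P] (hm : m ≤ m0) {D v : Ω → ℝ} {K s : ℝ}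
    (hD : AEStronglyMeasurable D P) (hDK : ∀ ω, |D ω| ≤ K)
    (hv0 : ∀ ω, 0 ≤ v ω) (hvK : ∀ ω, v ω ≤ K ^ 2) (hD1 : P[D | m] =ᵐ[P] 0)
    (hD2 : P[fun ω => D ω ^ 2 | m] =ᵐ[P] v) (hs : |s| * K ≤ 1) :
    ∀ᵐ ω ∂P, ‖(P[fun ω => Complex.exp ((s * D ω : ℝ) * Complex.I) | m]) ω
      * (Real.exp (s ^ 2 * v ω / 2) : ℂ) - 1‖ ≤ 10 * (|s| * K) ^ 3 := by
  obtain ⟨ω₀⟩ : Nonempty Ω := P.nonempty_of_neZero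
  have hK : 0 ≤ K := (abs_nonneg _).trans (hDK ω₀)
  have hq0 : 0 ≤ |s| * K := by positivity
  have hsD : ∀ ω, |s * D ω| ≤ |s| * K := fun ω => by
    rw [abs_mul]; exact mul_le_mul_of_nonneg_left (hDK ω) (abs_nonneg s)
  set F : Ω → ℂ := fun ω => Complex.exp ((s * D ω : ℝ) * Complex.I) with hF
  set A : Ω → ℂ := fun ω => (s * Complex.I) * (D ω : ℂ) with hA
  set Q : Ω → ℂ := fun ω => (-(s : ℂ) ^ 2 / 2) * ((D ω ^ 2 : ℝ) : ℂ) with hQ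
  have hDc : AEStronglyMeasurable (fun ω => (D ω : ℂ)) P :=
    Complex.continuous_ofReal.comp_aestronglyMeasurable hD
  have hFi : Integrable F P := by
    refine Integrable.of_bound (C := 1) ?_ (ae_of_all _ fun ω => ?_)
    · have : Continuous fun d : ℝ => Complex.exp ((s * d : ℝ) * Complex.I) := by fun_prop
      exact this.comp_aestronglyMeasurable hD
    · simp only [hF]; rw [Complex.norm_exp_ofReal_mul_I]
  have hDi : Integrable D P := Integrable.of_bound hD K (ae_of_all _ hDK)
  have hD2i : Integrable (fun ω => D ω ^ 2) P := by
    refine Integrable.of_bound (hD.pow 2) (K ^ 2) (ae_of_all _ fun ω => ?_)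
    rw [norm_pow]; exact pow_le_pow_left₀ (norm_nonneg _) (hDK ω) 2
  have hAi : Integrable A P := (hDi.ofReal (𝕜 := ℂ)).const_mul _
  have hQi : Integrable Q P := (hD2i.ofReal (𝕜 := ℂ)).const_mul _
  have hcof : ∀ {f : Ω → ℝ}, Integrable f P → ∀ c : ℂ,
      P[fun ω => c * (f ω : ℂ) | m] =ᵐ[P] fun ω => c * ((P[f | m]) ω : ℂ) := by
    intro f hf c
    have := ContinuousLinearMap.comp_condExp_comm (m := m) hf
      ((c • Complex.ofRealCLM : ℝ →L[ℝ] ℂ))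
    exact this.symm
  have hAc := hcof hDi (s * Complex.I)
  have hQc := hcof hD2i (-(s : ℂ) ^ 2 / 2)
  have hcomb : P[fun ω => F ω - (1 + A ω + Q ω) | m] =ᵐ[P]
      fun ω => (P[F | m]) ω - (1 + (P[A | m]) ω + (P[Q | m]) ω) := by
    have e1 := condExp_sub hFi (((integrable_const (1 : ℂ)).add hAi).add hQi) m
    have e2 := condExp_add ((integrable_const (1 : ℂ)).add hAi) hQi m
    have e3 := condExp_add (integrable_const (1 : ℂ)) hAi m
    have e4 : P[fun _ : Ω => (1 : ℂ) | m] = fun _ => 1 := condExp_const hm 1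
    filter_upwards [e1, e2, e3] with ω h1 h2 h3
    refine Eq.trans h1 ?_
    simp only [Pi.sub_apply, Pi.add_apply] at h2 h3 ⊢
    rw [h2, h3, e4]
  have hbd : ∀ᵐ ω ∂P, ‖(P[fun ω => F ω - (1 + A ω + Q ω) | m]) ω‖ ≤ 3 * (|s| * K) ^ 3 := by
    refine ae_bdd_norm_condExp_of_ae_bdd_norm (ae_of_all _ fun ω => ?_)
    have h := norm_cexp_mul_I_sub_taylor_le ((hsD ω).trans hs)
    have e : F ω - (1 + A ω + Q ω) = Complex.exp ((s * D ω : ℝ) * Complex.I)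
        - (1 + (s * D ω : ℝ) * Complex.I - ((s * D ω : ℝ) : ℂ) ^ 2 / 2) := by
      simp only [hF, hA, hQ]; push_cast; ring
    rw [e]
    refine h.trans ?_
    gcongr
    exact hsD ω
  filter_upwards [hcomb, hbd, hAc, hQc, hD1, hD2] with ω h1 h2 h3 h4 h5 h6
  rw [h1] at h2
  set u : ℝ := s ^ 2 * v ω / 2 with hu
  have hu0 : 0 ≤ u := by have := hv0 ω; positivity
  have huq : u ≤ (|s| * K) ^ 2 / 2 := by
    rw [hu, mul_pow, sq_abs]
    have := mul_le_mul_of_nonneg_left (hvK ω) (sq_nonneg s)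
    linarith
  have hq2 : (|s| * K) ^ 2 ≤ 1 := by nlinarith
  have hu1 : u ≤ 1 := by linarith
  have hT : 1 + (P[A | m]) ω + (P[Q | m]) ω = ((1 - u : ℝ) : ℂ) := by
    rw [h3, h4, h5, h6]; simp [hu]; ring
  rw [hT] at h2
  have hue : Real.exp u ≤ 2 := by
    have h : Real.exp u ≤ Real.exp (1 / 2) := Real.exp_le_exp.2 (by linarith)
    have h2 : Real.exp (1 / 2) ^ 2 = Real.exp 1 := by rw [← Real.exp_nat_mul]; norm_num
    have := Real.exp_one_lt_d9
    nlinarith [Real.exp_pos (1 / 2)]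
  have hsplit : (P[F | m]) ω * (Real.exp u : ℂ) - 1
      = ((P[F | m]) ω - ((1 - u : ℝ) : ℂ)) * (Real.exp u : ℂ)
        + (((1 - u) * Real.exp u - 1 : ℝ) : ℂ) := by push_cast; ring
  rw [hsplit]
  refine (norm_add_le _ _).trans ?_
  rw [norm_mul, Complex.norm_real, Complex.norm_real, Real.norm_eq_abs, Real.norm_eq_abs,
    abs_of_pos (Real.exp_pos u)]
  have h7 := abs_one_sub_mul_exp_sub_one_le hu0 hu1
  have h8 : u ^ 2 ≤ (|s| * K) ^ 3 / 4 := by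
    have : u ^ 2 ≤ ((|s| * K) ^ 2 / 2) ^ 2 := pow_le_pow_left₀ hu0 huq 2
    have h9 : (|s| * K) ^ 4 ≤ (|s| * K) ^ 3 := pow_le_pow_of_le_one hq0 hs (by norm_num)
    nlinarith
  -- The Taylor error contributes `3 * 2` and `3 * u ^ 2` contributes `3 / 4`, in units of `(|s| *
  -- K) ^ 3`; the constant 10 is a rounding up.
  have h10 := mul_le_mul h2 hue (Real.exp_pos u).le (by positivity)
  have : 0 ≤ (|s| * K) ^ 3 := by positivity
  linarith

/-! ### Exponential almost-martingales of a bounded martingale -/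

/-- A martingale `M` whose increments are `α (n + 1) * D n`, with `D` and `M` bounded by `K` and
conditional variances `v n` of `D n`. -/
structure BoundedIncrements {Ω : Type*} {m0 : MeasurableSpace Ω} (P : Measure Ω)
    (ℱ : Filtration ℕ m0) (α : ℕ → ℝ) (M D v : ℕ → Ω → ℝ) (K : ℝ) : Prop where
  step : ∀ n ω, M (n + 1) ω = M n ω + α (n + 1) * D n ω
  meas : ∀ n, Measurable[ℱ n] (M n)
  meas_incr : ∀ n, Measurable (D n)
  meas_var : ∀ n, Measurable[ℱ n] (v n)
  abs_mart_le : ∀ n ω, |M n ω| ≤ K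
  abs_incr_le : ∀ n ω, |D n ω| ≤ K
  var_nonneg : ∀ n ω, 0 ≤ v n ω
  var_le : ∀ n ω, v n ω ≤ K ^ 2
  condExp_incr : ∀ n, P[D n | ℱ n] =ᵐ[P] 0
  condExp_incr_sq : ∀ n, P[fun ω => D n ω ^ 2 | ℱ n] =ᵐ[P] v n

/-- The exponential `exp (i c (M n - M (n + i)))`, normalised by the conditional variances. -/
noncomputable def expPartial {Ω : Type*} (α : ℕ → ℝ) (M v : ℕ → Ω → ℝ) (n : ℕ) (c : ℝ)
    (i : ℕ) (ω : Ω) : ℂ :=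
  Complex.exp ((c * (M n ω - M (n + i) ω) : ℝ) * Complex.I) *
    (Real.exp (c ^ 2 / 2 * ∑ j ∈ Finset.range i, α (n + j + 1) ^ 2 * v (n + j) ω) : ℂ)

/-- The limit of `expPartial`, with `M'` the limit of `M`. -/
noncomputable def expLimit {Ω : Type*} (α : ℕ → ℝ) (M v : ℕ → Ω → ℝ) (M' : Ω → ℝ) (n : ℕ) (c : ℝ)
    (ω : Ω) : ℂ :=
  Complex.exp ((c * (M n ω - M' ω) : ℝ) * Complex.I) *
    (Real.exp (c ^ 2 / 2 * ∑' j, α (n + j + 1) ^ 2 * v (n + j) ω) : ℂ)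

namespace BoundedIncrements

variable {Ω : Type*} {m0 : MeasurableSpace Ω} {P : Measure Ω} {ℱ : Filtration ℕ m0} {α : ℕ → ℝ}
  {M D v : ℕ → Ω → ℝ} {K : ℝ} {M' v' : Ω → ℝ}

theorem norm_expPartial_le (h : BoundedIncrements P ℱ α M D v K) {n : ℕ} {c R : ℝ}
    (hR : ∀ i, c ^ 2 * K ^ 2 * ∑ j ∈ Finset.range i, α (n + j + 1) ^ 2 ≤ R) (i : ℕ) (ω : Ω) :
    ‖expPartial α M v n c i ω‖ ≤ Real.exp (R / 2) := by
  rw [expPartial, norm_mul, Complex.norm_exp_ofReal_mul_I, one_mul, Complex.norm_real,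
    Real.norm_eq_abs, abs_of_pos (Real.exp_pos _)]
  refine Real.exp_le_exp.2 ?_
  have h1 : ∑ j ∈ Finset.range i, α (n + j + 1) ^ 2 * v (n + j) ω
      ≤ ∑ j ∈ Finset.range i, α (n + j + 1) ^ 2 * K ^ 2 :=
    Finset.sum_le_sum fun j _ => mul_le_mul_of_nonneg_left (h.var_le _ _) (sq_nonneg _)
  rw [← Finset.sum_mul] at h1
  have h2 := hR i
  have h3 := mul_le_mul_of_nonneg_left h1 (sq_nonneg c)
  linarith

theorem measurable_expPartial (h : BoundedIncrements P ℱ α M D v K) (n : ℕ) (c : ℝ) (i : ℕ) :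
    Measurable[ℱ (n + i)] (expPartial α M v n c i) := by
  have h1 : Measurable[ℱ (n + i)] (M n) := (h.meas n).mono (ℱ.mono (Nat.le_add_right _ _)) le_rfl
  have h2 := h.meas (n + i)
  have h3 : Measurable[ℱ (n + i)]
      (fun ω => ∑ j ∈ Finset.range i, α (n + j + 1) ^ 2 * v (n + j) ω) := by
    refine Finset.measurable_fun_sum _ fun j hj => ?_
    exact ((h.meas_var (n + j)).mono
      (ℱ.mono (Nat.add_le_add_left (Finset.mem_range.1 hj).le _)) le_rfl).const_mul _
  unfold expPartial
  fun_prop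

/-- Each new factor has conditional expectation within a cubic error of 1, and what it multiplies is
known at that time and bounded by `exp (R / 2)`. The one-step errors therefore add up. -/
theorem norm_condExp_expPartial_sub_one_le [IsProbabilityMeasure P]
    (h : BoundedIncrements P ℱ α M D v K) {n : ℕ} {c R : ℝ}
    (hc : ∀ j, |c * α (n + j + 1)| * K ≤ 1)
    (hR : ∀ i, c ^ 2 * K ^ 2 * ∑ j ∈ Finset.range i, α (n + j + 1) ^ 2 ≤ R) (i : ℕ) :
    ∀ᵐ ω ∂P, ‖(P[expPartial α M v n c i | ℱ n]) ω - 1‖ ≤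
      10 * Real.exp (R / 2) * ∑ j ∈ Finset.range i, (|c * α (n + j + 1)| * K) ^ 3 := by
  have hint : ∀ i, Integrable (expPartial α M v n c i) P := fun i =>
    Integrable.of_bound ((h.measurable_expPartial n c i).mono (ℱ.le _) le_rfl).aestronglyMeasurable
      _ (ae_of_all _ (h.norm_expPartial_le hR i))
  induction i with
  | zero =>
    have : expPartial α M v n c 0 = fun _ => 1 := by
      funext ω; simp [expPartial]
    rw [this, condExp_const (ℱ.le n)]
    simp
  | succ i ih =>
    -- The sign is negative because the new increment enters through `- M (n + i + 1)`.
    set s : ℝ := -(c * α (n + i + 1)) with hs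
    set W : Ω → ℂ := fun ω => Complex.exp ((s * D (n + i) ω : ℝ) * Complex.I) with hW
    set e : Ω → ℂ := fun ω => (Real.exp (s ^ 2 * v (n + i) ω / 2) : ℂ) with he
    have hsucc : ∀ ω, expPartial α M v n c (i + 1) ω = (expPartial α M v n c i ω * e ω) * W ω := by
      intro ω
      simp only [expPartial, hW, he, Finset.sum_range_succ]
      rw [← add_assoc, h.step (n + i) ω, mul_add (c ^ 2 / 2), Real.exp_add]
      have e1 : (c * (M n ω - (M (n + i) ω + α (n + i + 1) * D (n + i) ω)) : ℝ)
          = c * (M n ω - M (n + i) ω) + s * D (n + i) ω := by rw [hs]; ring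
      have e2 : c ^ 2 / 2 * (α (n + i + 1) ^ 2 * v (n + i) ω) = s ^ 2 * v (n + i) ω / 2 := by
        rw [hs]; ring
      rw [e1, e2, Complex.ofReal_add, add_mul, Complex.exp_add]
      push_cast
      ring
    have hWi : Integrable W P := by
      refine Integrable.of_bound (C := 1) ?_ (ae_of_all _ fun ω => ?_)
      · have : Measurable W := by have := h.meas_incr (n + i); fun_prop
        exact this.aestronglyMeasurable
      · simp only [hW]; rw [Complex.norm_exp_ofReal_mul_I]
    have hem : Measurable[ℱ (n + i)] e := by have := h.meas_var (n + i); fun_prop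
    have hpm : StronglyMeasurable[ℱ (n + i)] (fun ω => expPartial α M v n c i ω * e ω) :=
      ((h.measurable_expPartial n c i).mul hem).stronglyMeasurable
    have hpull : P[expPartial α M v n c (i + 1) | ℱ (n + i)] =ᵐ[P]
        fun ω => (expPartial α M v n c i ω * e ω) * (P[W | ℱ (n + i)]) ω := by
      have := condExp_bilin_of_stronglyMeasurable_left (ContinuousLinearMap.mul ℝ ℂ) hpm
        (g := W) (by
          refine (hint (i + 1)).congr (ae_of_all _ fun ω => ?_)
          simpa using hsucc ω) hWi
      rw [show expPartial α M v n c (i + 1) = fun ω => (expPartial α M v n c i ω * e ω) * W ω from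
        funext hsucc]
      simpa using this
    have hself : P[expPartial α M v n c i | ℱ (n + i)] = expPartial α M v n c i :=
      condExp_of_stronglyMeasurable (ℱ.le _) (h.measurable_expPartial n c i).stronglyMeasurable
        (hint i)
    have hstep := norm_condExp_cexp_mul_sub_one_le (P := P) (s := s) (ℱ.le (n + i))
      (h.meas_incr (n + i)).aestronglyMeasurable (h.abs_incr_le (n + i)) (h.var_nonneg (n + i))
      (h.var_le (n + i)) (h.condExp_incr (n + i)) (h.condExp_incr_sq (n + i))
      (by rw [hs, abs_neg]; exact hc i)
    have hdiff : ∀ᵐ ω ∂P, ‖(P[fun ω => expPartial α M v n c (i + 1) ω - expPartial α M v n c i ω |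
        ℱ (n + i)]) ω‖ ≤ Real.exp (R / 2) * (10 * (|c * α (n + i + 1)| * K) ^ 3) := by
      filter_upwards [hpull, hstep, condExp_sub (hint (i + 1)) (hint i) (ℱ (n + i))]
        with ω h1 h2 h3
      have h3' : (P[fun ω => expPartial α M v n c (i + 1) ω - expPartial α M v n c i ω |
        ℱ (n + i)]) ω = (P[expPartial α M v n c (i + 1) | ℱ (n + i)]) ω
          - (P[expPartial α M v n c i | ℱ (n + i)]) ω := h3
      rw [h3', h1, hself]
      have : expPartial α M v n c i ω * e ω * (P[W | ℱ (n + i)]) ω - expPartial α M v n c i ω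
          = expPartial α M v n c i ω * ((P[W | ℱ (n + i)]) ω * e ω - 1) := by ring
      rw [this, norm_mul]
      refine mul_le_mul (h.norm_expPartial_le hR i ω) ?_ (norm_nonneg _) (Real.exp_pos _).le
      rw [hs, abs_neg] at h2
      exact h2
    -- The one-step error is estimated given `ℱ (n + i)`; a deterministic bound survives further
    -- conditioning on `ℱ n`.
    have htower := condExp_condExp_of_le (μ := P)
      (f := fun ω => expPartial α M v n c (i + 1) ω - expPartial α M v n c i ω)
      (ℱ.mono (Nat.le_add_right n i)) (ℱ.le (n + i))
    filter_upwards [ih, htower, ae_bdd_norm_condExp_of_ae_bdd_norm (m := ℱ n) hdiff,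
      condExp_sub (hint (i + 1)) (hint i) (ℱ n)] with ω h1 h2 h3 h4
    rw [h2] at h3
    have h4' : (P[fun ω => expPartial α M v n c (i + 1) ω - expPartial α M v n c i ω | ℱ n]) ω
        = (P[expPartial α M v n c (i + 1) | ℱ n]) ω - (P[expPartial α M v n c i | ℱ n]) ω := h4
    rw [h4'] at h3
    rw [Finset.sum_range_succ, mul_add]
    calc ‖(P[expPartial α M v n c (i + 1) | ℱ n]) ω - 1‖
        = ‖((P[expPartial α M v n c i | ℱ n]) ω - 1) + ((P[expPartial α M v n c (i + 1) | ℱ n]) ω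
          - (P[expPartial α M v n c i | ℱ n]) ω)‖ := by congr 1; ring
      _ ≤ _ := norm_add_le _ _
      _ ≤ _ := by linarith

theorem summable_var (h : BoundedIncrements P ℱ α M D v K) (hα : Summable fun n => α n ^ 2)
    (n : ℕ) (ω : Ω) : Summable fun j => α (n + j + 1) ^ 2 * v (n + j) ω := by
  have h1 : Summable fun j => α (n + j + 1) ^ 2 := by
    have := (summable_nat_add_iff (n + 1)).2 hα
    refine this.congr fun j => by congr 2; ring
  refine Summable.of_nonneg_of_le (fun j => mul_nonneg (sq_nonneg _) (h.var_nonneg _ _))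
    (fun j => mul_le_mul_of_nonneg_left (h.var_le _ _) (sq_nonneg _)) (h1.mul_right (K ^ 2))

theorem ae_tendsto_expPartial (h : BoundedIncrements P ℱ α M D v K)
    (hα : Summable fun n => α n ^ 2)
    (hM : ∀ᵐ ω ∂P, Tendsto (fun n => M n ω) atTop (𝓝 (M' ω))) (n : ℕ) (c : ℝ) :
    ∀ᵐ ω ∂P, Tendsto (fun i => expPartial α M v n c i ω) atTop (𝓝 (expLimit α M v M' n c ω)) := by
  filter_upwards [hM] with ω hω
  have h1 : Tendsto (fun i => M (n + i) ω) atTop (𝓝 (M' ω)) := by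
    simpa [add_comm] using (tendsto_add_atTop_iff_nat n).2 hω
  have h2 := (h.summable_var hα n ω).hasSum.tendsto_sum_nat
  unfold expPartial expLimit
  refine Tendsto.mul ?_ ?_
  · have : Continuous fun d : ℝ => Complex.exp ((c * (M n ω - d) : ℝ) * Complex.I) := by fun_prop
    exact (this.tendsto _).comp h1
  · have : Continuous fun d : ℝ => (Real.exp (c ^ 2 / 2 * d) : ℂ) := by fun_prop
    exact (this.tendsto _).comp h2

theorem norm_condExp_expLimit_sub_one_le [IsProbabilityMeasure P]
    (h : BoundedIncrements P ℱ α M D v K) (hα : Summable fun n => α n ^ 2)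
    (hM : ∀ᵐ ω ∂P, Tendsto (fun n => M n ω) atTop (𝓝 (M' ω))) {n : ℕ} {c R δ : ℝ}
    (hc : ∀ j, |c * α (n + j + 1)| * K ≤ δ) (hδ : δ ≤ 1)
    (hR : c ^ 2 * K ^ 2 * ∑' j, α (n + j + 1) ^ 2 ≤ R) :
    ∀ᵐ ω ∂P, ‖(P[expLimit α M v M' n c | ℱ n]) ω - 1‖ ≤ 10 * Real.exp (R / 2) * (δ * R) := by
  obtain ⟨ω₀⟩ : Nonempty Ω := P.nonempty_of_neZero
  have hK : 0 ≤ K := (abs_nonneg _).trans (h.abs_mart_le 0 ω₀)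
  have hδ0 : 0 ≤ δ := le_trans (by positivity) (hc 0)
  have hsum : Summable fun j => α (n + j + 1) ^ 2 := by
    have := (summable_nat_add_iff (n + 1)).2 hα
    refine this.congr fun j => by congr 2; ring
  have hR' : ∀ i, c ^ 2 * K ^ 2 * ∑ j ∈ Finset.range i, α (n + j + 1) ^ 2 ≤ R := fun i =>
    le_trans (mul_le_mul_of_nonneg_left
      (hsum.sum_le_tsum _ fun j _ => sq_nonneg _) (by positivity)) hR
  -- One factor of each cube is bounded by `δ`; the remaining squares sum to at most `R`.
  have hcub : ∀ i, ∑ j ∈ Finset.range i, (|c * α (n + j + 1)| * K) ^ 3 ≤ δ * R := by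
    intro i
    calc ∑ j ∈ Finset.range i, (|c * α (n + j + 1)| * K) ^ 3
        ≤ ∑ j ∈ Finset.range i, δ * (c ^ 2 * K ^ 2 * α (n + j + 1) ^ 2) := by
          refine Finset.sum_le_sum fun j _ => ?_
          have : (|c * α (n + j + 1)| * K) ^ 2 = c ^ 2 * K ^ 2 * α (n + j + 1) ^ 2 := by
            rw [mul_pow, sq_abs]; ring
          rw [pow_succ', this]
          exact mul_le_mul_of_nonneg_right (hc j) (by positivity)
      _ = δ * (c ^ 2 * K ^ 2 * ∑ j ∈ Finset.range i, α (n + j + 1) ^ 2) := by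
          rw [Finset.mul_sum, Finset.mul_sum]
      _ ≤ δ * R := mul_le_mul_of_nonneg_left (hR' i) hδ0
  obtain ⟨ns, -, hns⟩ := exists_subseq_tendsto_condExp (m := ℱ n)
    (fun i => ((h.measurable_expPartial n c i).mono (ℱ.le _) le_rfl).aestronglyMeasurable)
    (fun i => ae_of_all P (h.norm_expPartial_le hR' i)) (h.ae_tendsto_expPartial hα hM n c)
  filter_upwards [hns, ae_all_iff.2 fun i => h.norm_condExp_expPartial_sub_one_le
    (fun j => (hc j).trans hδ) hR' i] with ω h1 h2
  refine le_of_tendsto (h1.sub_const 1).norm (Eventually.of_forall fun i => (h2 (ns i)).trans ?_)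
  exact mul_le_mul_of_nonneg_left (hcub _) (by positivity)

/-- Martingale increments are orthogonal given `ℱ n`, so the second moment is a sum of terms at most
`α² K²`. The bound supplies the equicontinuity of the conditional characteristic functions. -/
theorem condExp_sq_le [IsProbabilityMeasure P]
    (h : BoundedIncrements P ℱ α M D v K) (hα : Summable fun n => α n ^ 2)
    (hM : ∀ᵐ ω ∂P, Tendsto (fun n => M n ω) atTop (𝓝 (M' ω))) (n : ℕ) :
    ∀ᵐ ω ∂P, (P[fun ω => (M n ω - M' ω) ^ 2 | ℱ n]) ω ≤ K ^ 2 * ∑' j, α (n + j + 1) ^ 2 := by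
  obtain ⟨ω₀⟩ : Nonempty Ω := P.nonempty_of_neZero
  have hK : 0 ≤ K := (abs_nonneg _).trans (h.abs_mart_le 0 ω₀)
  have hsum : Summable fun j => α (n + j + 1) ^ 2 := by
    have := (summable_nat_add_iff (n + 1)).2 hα
    refine this.congr fun j => by congr 2; ring
  have hMm : ∀ k, Measurable (M k) := fun k => (h.meas k).mono (ℱ.le _) le_rfl
  have hdB : ∀ i ω, |M n ω - M (n + i) ω| ≤ 2 * K := fun i ω =>
    (abs_sub _ _).trans (by linarith [h.abs_mart_le n ω, h.abs_mart_le (n + i) ω])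
  have hsqm : ∀ i, Measurable (fun ω => (M n ω - M (n + i) ω) ^ 2) := fun i =>
    ((hMm n).sub (hMm _)).pow_const 2
  have hsqB : ∀ i ω, ‖(M n ω - M (n + i) ω) ^ 2‖ ≤ (2 * K) ^ 2 := fun i ω => by
    rw [norm_pow]; exact pow_le_pow_left₀ (norm_nonneg _) (hdB i ω) 2
  have hsqi : ∀ i, Integrable (fun ω => (M n ω - M (n + i) ω) ^ 2) P := fun i =>
    Integrable.of_bound (hsqm i).aestronglyMeasurable _ (ae_of_all _ (hsqB i))
  have hpartial : ∀ i, ∀ᵐ ω ∂P, (P[fun ω => (M n ω - M (n + i) ω) ^ 2 | ℱ n]) ω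
      ≤ K ^ 2 * ∑ j ∈ Finset.range i, α (n + j + 1) ^ 2 := by
    intro i
    induction i with
    | zero =>
      have : (fun ω => (M n ω - M (n + 0) ω) ^ 2) = fun _ => (0 : ℝ) := by funext ω; simp
      rw [this, condExp_const (ℱ.le n)]
      simp
    | succ i ih =>
      set a := α (n + i + 1) with ha
      set X : Ω → ℝ := fun ω => (-2 * a) * (M n ω - M (n + i) ω) with hX
      have hXm : Measurable[ℱ (n + i)] X :=
        (((h.meas n).mono (ℱ.mono (Nat.le_add_right _ _)) le_rfl).sub
          (h.meas (n + i))).const_mul _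
      have hDi : Integrable (D (n + i)) P :=
        Integrable.of_bound (h.meas_incr _).aestronglyMeasurable K
          (ae_of_all _ (h.abs_incr_le (n + i)))
      have hXDi : Integrable (X * D (n + i)) P :=
        hDi.bdd_mul (c := |-2 * a| * (2 * K))
          (hXm.mono (ℱ.le _) le_rfl).aestronglyMeasurable (ae_of_all _ fun ω => by
            simp only [hX, norm_mul, Real.norm_eq_abs]
            rw [← abs_mul]
            exact mul_le_mul_of_nonneg_left (hdB i ω) (abs_nonneg _))
      set Y : Ω → ℝ := fun ω => a ^ 2 * D (n + i) ω ^ 2 with hY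
      have hYB : ∀ ω, ‖Y ω‖ ≤ a ^ 2 * K ^ 2 := fun ω => by
        simp only [hY, norm_mul, norm_pow, Real.norm_eq_abs, sq_abs]
        exact mul_le_mul_of_nonneg_left (sq_le_sq' (abs_le.1 (h.abs_incr_le _ ω)).1
          (abs_le.1 (h.abs_incr_le _ ω)).2) (sq_nonneg _)
      have hYi : Integrable Y P :=
        Integrable.of_bound (((h.meas_incr _).pow_const 2).const_mul _).aestronglyMeasurable
          _ (ae_of_all _ hYB)
      have hpull := condExp_mul_of_stronglyMeasurable_left hXm.stronglyMeasurable hXDi hDi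
      -- The cross term vanishes: `X` is known at time `n + i`, when `D (n + i)` is centred.
      have hX0 : P[X * D (n + i) | ℱ n] =ᵐ[P] 0 := by
        refine (condExp_condExp_of_le (ℱ.mono (Nat.le_add_right n i)) (ℱ.le (n + i))).symm.trans ?_
        have : P[X * D (n + i) | ℱ (n + i)] =ᵐ[P] 0 := by
          filter_upwards [hpull, h.condExp_incr (n + i)] with ω h1 h2
          rw [h1, Pi.mul_apply, h2]; simp
        exact (condExp_congr_ae this).trans (by rw [condExp_zero])
      have hdec : (fun ω => (M n ω - M (n + (i + 1)) ω) ^ 2)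
          = (fun ω => (M n ω - M (n + i) ω) ^ 2) + X * D (n + i) + Y := by
        funext ω
        simp only [Pi.add_apply, Pi.mul_apply, hX, hY]
        rw [← add_assoc, h.step (n + i) ω]
        ring
      rw [hdec]
      filter_upwards [ih, hX0, condExp_add ((hsqi i).add hXDi) hYi (ℱ n),
        condExp_add (hsqi i) hXDi (ℱ n),
        ae_bdd_norm_condExp_of_ae_bdd_norm (m := ℱ n) (ae_of_all P hYB)] with ω h1 h2 h3 h4 h5
      rw [h3, Pi.add_apply, h4, Pi.add_apply, h2, Finset.sum_range_succ, mul_add]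
      have := (le_abs_self _).trans h5
      simp only [Pi.zero_apply]
      linarith
  have hlim : ∀ᵐ ω ∂P, Tendsto (fun i => (M n ω - M (n + i) ω) ^ 2) atTop
      (𝓝 ((M n ω - M' ω) ^ 2)) := by
    filter_upwards [hM] with ω hω
    have h1 : Tendsto (fun i => M (n + i) ω) atTop (𝓝 (M' ω)) := by
      simpa [add_comm] using (tendsto_add_atTop_iff_nat n).2 hω
    exact (h1.const_sub _).pow 2
  obtain ⟨ns, -, hns⟩ := exists_subseq_tendsto_condExp (m := ℱ n)
    (fun i => (hsqm i).aestronglyMeasurable) (fun i => ae_of_all P (hsqB i)) hlim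
  filter_upwards [hns, ae_all_iff.2 hpartial] with ω h1 h2
  refine le_of_tendsto h1 (Eventually.of_forall fun i => (h2 (ns i)).trans ?_)
  exact mul_le_mul_of_nonneg_left (hsum.sum_le_tsum _ fun j _ => sq_nonneg _) (sq_nonneg _)

end BoundedIncrements

/-! ### Convergence of the conditional characteristic functions -/

/-- A Toeplitz argument: the weights `b n * α (n + j + 1) ^ 2` are nonnegative, have total mass
tending to 1, and see only the values of `x` from index `n` on. -/
theorem tendsto_mul_tsum_of_tendsto {α b x : ℕ → ℝ} {l K : ℝ} (hα : Summable fun n => α n ^ 2)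
    (hb : ∀ᶠ n in atTop, 0 ≤ b n)
    (htail : Tendsto (fun n => b n * ∑' j, α (n + j + 1) ^ 2) atTop (𝓝 1))
    (hx : Tendsto x atTop (𝓝 l)) (hxK : ∀ n, |x n| ≤ K) :
    Tendsto (fun n => b n * ∑' j, α (n + j + 1) ^ 2 * x (n + j)) atTop (𝓝 l) := by
  have hsum : ∀ n, Summable fun j => α (n + j + 1) ^ 2 := fun n => by
    have := (summable_nat_add_iff (n + 1)).2 hα
    refine this.congr fun j => by congr 2; ring
  have hsumx : ∀ n, Summable fun j => α (n + j + 1) ^ 2 * x (n + j) := fun n => by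
    refine Summable.of_norm_bounded ((hsum n).mul_right K) fun j => ?_
    rw [norm_mul, Real.norm_eq_abs, abs_of_nonneg (sq_nonneg _)]
    exact mul_le_mul_of_nonneg_left (hxK _) (sq_nonneg _)
  have hl : Tendsto (fun n => l * (b n * ∑' j, α (n + j + 1) ^ 2)) atTop (𝓝 l) := by
    simpa using htail.const_mul l
  have hdiff : Tendsto (fun n => b n * ∑' j, α (n + j + 1) ^ 2 * x (n + j)
      - l * (b n * ∑' j, α (n + j + 1) ^ 2)) atTop (𝓝 0) := by
    rw [Metric.tendsto_atTop]
    intro ε hε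
    -- With total weight below 2, closeness `ε / 4` gives an error of at most `ε / 2`.
    obtain ⟨N, hN⟩ := Metric.tendsto_atTop.1 hx (ε / 4) (by positivity)
    obtain ⟨N', hN'⟩ := eventually_atTop.1 (hb.and (htail.eventually
      (gt_mem_nhds (show (1 : ℝ) < 2 by norm_num))))
    refine ⟨max N N', fun n hn => ?_⟩
    obtain ⟨hb0, hb2⟩ := hN' n (le_of_max_le_right hn)
    have hrw : b n * ∑' j, α (n + j + 1) ^ 2 * x (n + j) - l * (b n * ∑' j, α (n + j + 1) ^ 2)
        = b n * ∑' j, α (n + j + 1) ^ 2 * (x (n + j) - l) := by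
      have : (fun j => α (n + j + 1) ^ 2 * (x (n + j) - l))
          = fun j => α (n + j + 1) ^ 2 * x (n + j) - α (n + j + 1) ^ 2 * l := by
        funext j; ring
      rw [this, (hsumx n).tsum_sub ((hsum n).mul_right l), tsum_mul_right]
      ring
    have hbd : ‖∑' j, α (n + j + 1) ^ 2 * (x (n + j) - l)‖
        ≤ (∑' j, α (n + j + 1) ^ 2) * (ε / 4) := by
      rw [← tsum_mul_right]
      refine tsum_of_norm_bounded ((hsum n).mul_right (ε / 4)).hasSum fun j => ?_
      rw [norm_mul, Real.norm_eq_abs, abs_of_nonneg (sq_nonneg _)]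
      refine mul_le_mul_of_nonneg_left ?_ (sq_nonneg _)
      have := hN (n + j) (by have := le_of_max_le_left hn; omega)
      rw [Real.dist_eq] at this
      exact this.le
    rw [Real.dist_eq, sub_zero, hrw, abs_mul, abs_of_nonneg hb0]
    have := mul_le_mul_of_nonneg_left hbd hb0
    rw [Real.norm_eq_abs] at this
    nlinarith
  simpa using hdiff.add hl

namespace BoundedIncrements

variable {Ω : Type*} {m0 : MeasurableSpace Ω} {P : Measure Ω} {ℱ : Filtration ℕ m0} {α : ℕ → ℝ}
  {M D v : ℕ → Ω → ℝ} {K : ℝ} {M' v' : Ω → ℝ}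

theorem measurable_tsum_var (h : BoundedIncrements P ℱ α M D v K)
    (hα : Summable fun n => α n ^ 2) (n : ℕ) :
    Measurable fun ω => ∑' j, α (n + j + 1) ^ 2 * v (n + j) ω := by
  refine measurable_of_tendsto_metrizable (f := fun i ω =>
    ∑ j ∈ Finset.range i, α (n + j + 1) ^ 2 * v (n + j) ω) (fun i => ?_) ?_
  · exact Finset.measurable_fun_sum _ fun j _ =>
      ((h.meas_var (n + j)).mono (ℱ.le _) le_rfl).const_mul _
  · exact tendsto_pi_nhds.2 fun ω => (h.summable_var hα n ω).hasSum.tendsto_sum_nat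

theorem measurable_expLimit (h : BoundedIncrements P ℱ α M D v K)
    (hα : Summable fun n => α n ^ 2) (hM' : Measurable M') (n : ℕ) (c : ℝ) :
    Measurable (expLimit α M v M' n c) := by
  have h1 : Measurable (M n) := (h.meas n).mono (ℱ.le _) le_rfl
  have h2 := h.measurable_tsum_var hα n
  unfold expLimit
  fun_prop

/-- Write `X = e Z + (X - e Z)`. The factor `e n` comes out of the conditional expectation and `E[Z
n | ℱ n]` is close to 1, so the first term behaves like `e n`, which converges to the claimed limit.
The second has norm `W n`, and Hunt's lemma applies. -/
theorem ae_tendsto_condExp_cexp [IsProbabilityMeasure P] (h : BoundedIncrements P ℱ α M D v K)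
    (hα : Summable fun n => α n ^ 2) (hM' : Measurable M')
    (hM : ∀ᵐ ω ∂P, Tendsto (fun n => M n ω) atTop (𝓝 (M' ω)))
    (hv : ∀ᵐ ω ∂P, Tendsto (fun n => v n ω) atTop (𝓝 (v' ω)))
    {b d : ℕ → ℝ} (hb : ∀ᶠ n in atTop, 0 ≤ b n) (hd : Tendsto d atTop (𝓝 0))
    (hbd : ∀ᶠ n in atTop, ∀ j, b n * α (n + j + 1) ^ 2 ≤ d n)
    (htail : Tendsto (fun n => b n * ∑' j, α (n + j + 1) ^ 2) atTop (𝓝 1)) (t : ℝ) :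
    ∀ᵐ ω ∂P, Tendsto (fun n => (P[fun ω =>
        Complex.exp ((t * (√(b n) * (M n ω - M' ω)) : ℝ) * Complex.I) | ℱ n]) ω) atTop
      (𝓝 (Real.exp (-(t ^ 2 / 2 * v' ω)) : ℂ)) := by
  obtain ⟨ω₀⟩ : Nonempty Ω := P.nonempty_of_neZero
  have hK : 0 ≤ K := (abs_nonneg _).trans (h.abs_mart_le 0 ω₀)
  have hsum : ∀ n, Summable fun j => α (n + j + 1) ^ 2 := fun n => by
    have := (summable_nat_add_iff (n + 1)).2 hα
    refine this.congr fun j => by congr 2; ring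
  set V : ℕ → Ω → ℝ := fun n ω => b n * ∑' j, α (n + j + 1) ^ 2 * v (n + j) ω with hV
  set X : ℕ → Ω → ℂ := fun n ω =>
    Complex.exp ((t * (√(b n) * (M n ω - M' ω)) : ℝ) * Complex.I) with hX
  set Z : ℕ → Ω → ℂ := fun n => expLimit α M v M' n (t * √(b n)) with hZ
  -- This uses `v n` and not `V n`, since the factor has to be `ℱ n`-measurable.
  set e : ℕ → Ω → ℂ := fun n ω => (Real.exp (-(t ^ 2 / 2 * v n ω)) : ℂ) with he
  set δ : ℕ → ℝ := fun n => |t| * K * √(d n) with hδ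
  set R : ℝ := t ^ 2 * K ^ 2 * 2 with hR
  set B : ℝ := 1 + Real.exp (t ^ 2 * K ^ 2) with hB
  -- The truncation makes `W` bounded for all `n`, as Hunt's lemma requires; it is inactive for `n ≥
  -- N`, where the exponential is at most `B - 1`.
  set W : ℕ → Ω → ℝ := fun n ω => min |1 - Real.exp (t ^ 2 / 2 * (V n ω - v n ω))| B with hW
  have hB0 : 0 ≤ B := by positivity
  have hMm : ∀ n, Measurable (M n) := fun n => (h.meas n).mono (ℱ.le _) le_rfl
  have hvm : ∀ n, Measurable (v n) := fun n => (h.meas_var n).mono (ℱ.le _) le_rfl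
  have hVm : ∀ n, Measurable (V n) := fun n => (h.measurable_tsum_var hα n).const_mul _
  have hXm : ∀ n, Measurable (X n) := fun n => by have := hMm n; fun_prop
  have hXn : ∀ n ω, ‖X n ω‖ = 1 := fun n ω => by
    simp only [hX]; rw [Complex.norm_exp_ofReal_mul_I]
  have hXi : ∀ n, Integrable (X n) P := fun n =>
    Integrable.of_bound (hXm n).aestronglyMeasurable 1 (ae_of_all _ fun ω => (hXn n ω).le)
  have hδ0 : Tendsto δ atTop (𝓝 0) := by
    have := (hd.sqrt).const_mul (|t| * K)
    simpa using this
  have hlarge : ∀ᶠ n in atTop, 0 ≤ b n ∧ (∀ j, b n * α (n + j + 1) ^ 2 ≤ d n) ∧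
      b n * ∑' j, α (n + j + 1) ^ 2 < 2 ∧ δ n < 1 :=
    hb.and (hbd.and ((htail.eventually (gt_mem_nhds (by norm_num))).and
      (hδ0.eventually (gt_mem_nhds one_pos))))
  obtain ⟨N, hN⟩ := eventually_atTop.1 hlarge
  have hW0 : ∀ n ω, 0 ≤ W n ω := fun n ω => le_min (abs_nonneg _) hB0
  have hWB : ∀ n ω, W n ω ≤ B := fun n ω => min_le_right _ _
  have hWm : ∀ n, AEMeasurable (W n) P := fun n => by
    have h1 := hVm n
    have h2 := hvm n
    have : Measurable fun ω => |1 - Real.exp (t ^ 2 / 2 * (V n ω - v n ω))| := by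
      have : Measurable fun ω => 1 - Real.exp (t ^ 2 / 2 * (V n ω - v n ω)) := by fun_prop
      exact this.abs
    exact (this.min measurable_const).aemeasurable
  have hVlim : ∀ᵐ ω ∂P, Tendsto (fun n => V n ω) atTop (𝓝 (v' ω)) := by
    filter_upwards [hv] with ω hω
    refine tendsto_mul_tsum_of_tendsto hα hb htail hω (K := K ^ 2) fun n => ?_
    rw [abs_of_nonneg (h.var_nonneg n ω)]; exact h.var_le n ω
  have hWlim : ∀ᵐ ω ∂P, Tendsto (fun n => W n ω) atTop (𝓝 0) := by
    filter_upwards [hv, hVlim] with ω h1 h2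
    have h3 := h2.sub h1
    have hc : Continuous fun y : ℝ => min |1 - Real.exp (t ^ 2 / 2 * y)| B := by fun_prop
    have := (hc.tendsto _).comp h3
    rw [show min |1 - Real.exp (t ^ 2 / 2 * (v' ω - v' ω))| B = 0 by simp [hB0]] at this
    exact this
  have hhunt := tendsto_condExp_zero_of_bounded (P := P) ℱ hWm hW0 hWB hWlim
  have hZX : ∀ n, N ≤ n → ∀ ω, e n ω * Z n ω = X n ω *
      (Real.exp (t ^ 2 / 2 * (V n ω - v n ω)) : ℂ) := by
    intro n hn ω
    have hb0 := (hN n hn).1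
    simp only [he, hZ, hX, hV, expLimit]
    rw [mul_pow, Real.sq_sqrt hb0,
      show t ^ 2 / 2 * (b n * ∑' j, α (n + j + 1) ^ 2 * v (n + j) ω - v n ω)
        = -(t ^ 2 / 2 * v n ω) + t ^ 2 * b n / 2 * ∑' j, α (n + j + 1) ^ 2 * v (n + j) ω by ring,
      Real.exp_add, mul_assoc t]
    push_cast
    ring
  have hVB : ∀ n, N ≤ n → ∀ ω, Real.exp (t ^ 2 / 2 * (V n ω - v n ω)) ≤
      Real.exp (t ^ 2 * K ^ 2) := by
    intro n hn ω
    refine Real.exp_le_exp.2 ?_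
    have h1 : ∑' j, α (n + j + 1) ^ 2 * v (n + j) ω ≤ (∑' j, α (n + j + 1) ^ 2) * K ^ 2 := by
      rw [← tsum_mul_right]
      exact (h.summable_var hα n ω).tsum_le_tsum
        (fun j => mul_le_mul_of_nonneg_left (h.var_le _ _) (sq_nonneg _))
        ((hsum n).mul_right _)
    have h2 : V n ω ≤ 2 * K ^ 2 := by
      refine (mul_le_mul_of_nonneg_left h1 (hN n hn).1).trans ?_
      rw [← mul_assoc]
      exact mul_le_mul_of_nonneg_right (hN n hn).2.2.1.le (sq_nonneg _)
    have h3 : V n ω - v n ω ≤ 2 * K ^ 2 := by linarith [h.var_nonneg n ω]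
    have := mul_le_mul_of_nonneg_left h3 (by positivity : 0 ≤ t ^ 2 / 2)
    linarith
  have hZi : ∀ n, N ≤ n → Integrable (Z n) P := by
    intro n hn
    refine Integrable.of_bound (C := Real.exp (t ^ 2 / 2 * K ^ 2) * Real.exp (t ^ 2 * K ^ 2))
      (h.measurable_expLimit hα hM' n _).aestronglyMeasurable (ae_of_all _ fun ω => ?_)
    have h1 : Z n ω = (Real.exp (t ^ 2 / 2 * v n ω) : ℂ) * (e n ω * Z n ω) := by
      simp only [he]
      rw [← mul_assoc, ← Complex.ofReal_mul, ← Real.exp_add]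
      simp
    rw [h1, hZX n hn, norm_mul, norm_mul, hXn, one_mul, Complex.norm_real, Complex.norm_real,
      Real.norm_eq_abs, Real.norm_eq_abs, abs_of_pos (Real.exp_pos _),
      abs_of_pos (Real.exp_pos _)]
    refine mul_le_mul (Real.exp_le_exp.2 ?_) (hVB n hn ω) (Real.exp_pos _).le (Real.exp_pos _).le
    exact mul_le_mul_of_nonneg_left (h.var_le _ _) (by positivity)
  have hem : ∀ n, Measurable[ℱ n] (e n) := fun n => by have := h.meas_var n; fun_prop
  have hen : ∀ n ω, ‖e n ω‖ ≤ 1 := fun n ω => by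
    simp only [he]
    rw [Complex.norm_real, Real.norm_eq_abs, abs_of_pos (Real.exp_pos _), Real.exp_le_one_iff]
    have := h.var_nonneg n ω
    have : 0 ≤ t ^ 2 / 2 * v n ω := by positivity
    linarith
  have heZi : ∀ n, N ≤ n → Integrable (fun ω => e n ω * Z n ω) P := fun n hn =>
    (hZi n hn).bdd_mul ((hem n).mono (ℱ.le _) le_rfl).aestronglyMeasurable
      (ae_of_all _ (hen n))
  have hWi : ∀ n, Integrable (W n) P := fun n =>
    Integrable.of_bound (hWm n).aestronglyMeasurable B
      (ae_of_all _ fun ω => by rw [Real.norm_eq_abs, abs_of_nonneg (hW0 n ω)]; exact hWB n ω)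
  have hmain : ∀ᵐ ω ∂P, ∀ n, N ≤ n → ‖(P[X n | ℱ n]) ω - e n ω‖ ≤
      (P[W n | ℱ n]) ω + 10 * Real.exp (R / 2) * (δ n * R) := by
    refine ae_all_iff.2 fun n => ?_
    by_cases hn : N ≤ n
    swap
    · exact ae_of_all _ fun ω h => absurd h hn
    obtain ⟨hb0, hbd', hb2, hδ1⟩ := hN n hn
    have hd0 : 0 ≤ d n := (mul_nonneg hb0 (sq_nonneg _)).trans (hbd' 0)
    have hXZ := condExp_sub (hXi n) (heZi n hn) (ℱ n)
    have hpull : P[fun ω => e n ω * Z n ω | ℱ n] =ᵐ[P] fun ω => e n ω * (P[Z n | ℱ n]) ω := by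
      have := condExp_bilin_of_stronglyMeasurable_left (ContinuousLinearMap.mul ℝ ℂ)
        (hem n).stronglyMeasurable (g := Z n) (by simpa using heZi n hn) (hZi n hn)
      simpa using this
    have hnorm := norm_condExp_le (m := ℱ n) (μ := P) (fun ω => X n ω - e n ω * Z n ω)
    have hWeq : ∀ ω, ‖X n ω - e n ω * Z n ω‖ = W n ω := by
      intro ω
      have : X n ω - e n ω * Z n ω
          = X n ω * ((1 - Real.exp (t ^ 2 / 2 * (V n ω - v n ω)) : ℝ) : ℂ) := by
        rw [hZX n hn]; push_cast; ring
      rw [this, norm_mul, hXn, one_mul, Complex.norm_real, Real.norm_eq_abs]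
      refine (min_eq_left ?_).symm
      refine (abs_sub _ _).trans ?_
      rw [abs_one, abs_of_pos (Real.exp_pos _)]
      exact add_le_add_right (hVB n hn ω) 1
    have hWeq' : (fun ω => ‖X n ω - e n ω * Z n ω‖) = W n := funext hWeq
    rw [hWeq'] at hnorm
    have hZ1 := h.norm_condExp_expLimit_sub_one_le (n := n) (c := t * √(b n)) (R := R) (δ := δ n)
      hα hM (fun j => by
        have : |t * √(b n) * α (n + j + 1)| = |t| * √(b n * α (n + j + 1) ^ 2) := by
          rw [Real.sqrt_mul hb0, Real.sqrt_sq_eq_abs, abs_mul, abs_mul,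
            abs_of_nonneg (Real.sqrt_nonneg _), mul_assoc]
        rw [this]
        have h2 := Real.sqrt_le_sqrt (hbd' j)
        calc |t| * √(b n * α (n + j + 1) ^ 2) * K ≤ |t| * √(d n) * K := by gcongr
          _ = δ n := by simp only [hδ]; ring) hδ1.le (by
        rw [mul_pow, Real.sq_sqrt hb0]
        have : t ^ 2 * K ^ 2 * (b n * ∑' j, α (n + j + 1) ^ 2) ≤ t ^ 2 * K ^ 2 * 2 :=
          mul_le_mul_of_nonneg_left hb2.le (by positivity)
        calc _ = t ^ 2 * K ^ 2 * (b n * ∑' j, α (n + j + 1) ^ 2) := by ring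
          _ ≤ _ := this)
    filter_upwards [hXZ, hpull, hnorm, hZ1] with ω h1 h2 h3 h4 _
    have h1' : (P[fun ω => X n ω - e n ω * Z n ω | ℱ n]) ω
        = (P[X n | ℱ n]) ω - (P[fun ω => e n ω * Z n ω | ℱ n]) ω := h1
    rw [h1', h2] at h3
    have : (P[X n | ℱ n]) ω - e n ω = ((P[X n | ℱ n]) ω - e n ω * (P[Z n | ℱ n]) ω)
        + e n ω * ((P[Z n | ℱ n]) ω - 1) := by ring
    rw [this]
    refine (norm_add_le _ _).trans (add_le_add h3 ?_)
    rw [norm_mul]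
    calc _ ≤ 1 * ‖(P[Z n | ℱ n]) ω - 1‖ := by gcongr; exact hen n ω
      _ ≤ _ := by rw [one_mul]; exact h4
  filter_upwards [hmain, hhunt, hv] with ω h1 h2 h3
  have he' : Tendsto (fun n => e n ω) atTop (𝓝 (Real.exp (-(t ^ 2 / 2 * v' ω)) : ℂ)) := by
    have : Continuous fun y : ℝ => (Real.exp (-(t ^ 2 / 2 * y)) : ℂ) := by fun_prop
    exact (this.tendsto _).comp h3
  have hz : Tendsto (fun n => (P[X n | ℱ n]) ω - e n ω) atTop (𝓝 0) := by
    refine squeeze_zero_norm' (eventually_atTop.2 ⟨N, fun n hn => h1 n hn⟩) ?_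
    have := h2.add (((hδ0.mul_const R)).const_mul (10 * Real.exp (R / 2)))
    simpa using this
  have := hz.add he'
  rw [zero_add] at this
  exact this.congr fun n => sub_add_cancel _ _

end BoundedIncrements

/-! ### Regular conditional laws -/

/-- A regular version of the conditional distribution of `X` given `m`. -/
noncomputable def regularCondDistrib {Ω : Type*} {m0 : MeasurableSpace Ω} (P : Measure Ω)
    [IsFiniteMeasure P] (m : MeasurableSpace Ω) (X : Ω → ℝ) : @Kernel Ω ℝ m _ :=
  -- Conditioning on `m` is conditioning on the identity map with values in `(Ω, m)`, which
  -- generates `m`.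
  @condDistrib Ω Ω ℝ _ _ _ m0 m X id P _

instance isMarkovKernel_regularCondDistrib {Ω : Type*} {m0 : MeasurableSpace Ω} (P : Measure Ω)
    [IsFiniteMeasure P] (m : MeasurableSpace Ω) (X : Ω → ℝ) :
    @IsMarkovKernel Ω ℝ m _ (regularCondDistrib P m X) := by
  unfold regularCondDistrib; infer_instance

/-- The values of `regularCondDistrib` as probability measures. -/
noncomputable def condLaw {Ω : Type*} {m0 : MeasurableSpace Ω} (P : Measure Ω)
    [IsFiniteMeasure P] (m : MeasurableSpace Ω) (X : Ω → ℝ) (ω : Ω) : ProbabilityMeasure ℝ :=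
  ⟨regularCondDistrib P m X ω,
    @IsMarkovKernel.isProbabilityMeasure Ω ℝ m _ _ (isMarkovKernel_regularCondDistrib P m X) ω⟩

section

variable {Ω : Type*} {m m0 : MeasurableSpace Ω} {P : Measure Ω} [IsFiniteMeasure P] {X : Ω → ℝ}

theorem isRegularCondDistrib_condLaw (hm : m ≤ m0) (hX : Measurable X) :
    IsRegularCondDistrib P m X (condLaw P m X) where
  measurable := @Kernel.measurable Ω ℝ m _ (regularCondDistrib P m X)
  condProb B hB := by
    have := condDistrib_ae_eq_condExp (mα := m0) (mβ := m) (μ := P) (X := id)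
      (measurable_id'' hm) hX hB
    rw [MeasurableSpace.comap_id] at this
    exact this.symm

theorem condExp_comp_ae_eq_integral_condLaw {E : Type*} [NormedAddCommGroup E] [NormedSpace ℝ E]
    [CompleteSpace E] (hm : m ≤ m0) (hX : Measurable X) {f : ℝ → E} (hf : StronglyMeasurable f)
    (hfi : Integrable (fun ω => f (X ω)) P) :
    P[fun ω => f (X ω) | m] =ᵐ[P] fun ω => ∫ x, f x ∂(condLaw P m X ω : Measure ℝ) := by
  have := condExp_ae_eq_integral_condDistrib (mα := m0) (mβ := m) (μ := P) (X := id)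
    (measurable_id'' hm) hX.aemeasurable hf hfi
  rw [MeasurableSpace.comap_id] at this
  exact this

theorem ae_integrable_condDistrib {E β : Type*} [NormedAddCommGroup E] {mβ : MeasurableSpace β}
    {T : Ω → β} (hT : Measurable T) (hX : Measurable X) {f : ℝ → E} (hf : StronglyMeasurable f)
    (hfi : Integrable (fun ω => f (X ω)) P) :
    ∀ᵐ ω ∂P, Integrable f (condDistrib X T P (T ω)) := by
  refine Integrable.condDistrib_ae (f := fun p => f p.2) hT.aemeasurable hX.aemeasurable ?_
  exact (integrable_map_measure (hf.comp_measurable measurable_snd).aestronglyMeasurable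
    (hT.prodMk hX).aemeasurable).2 hfi

theorem ae_integrable_condLaw {E : Type*} [NormedAddCommGroup E]
    (hm : m ≤ m0) (hX : Measurable X) {f : ℝ → E} (hf : StronglyMeasurable f)
    (hfi : Integrable (fun ω => f (X ω)) P) :
    ∀ᵐ ω ∂P, Integrable f (condLaw P m X ω : Measure ℝ) := by
  exact ae_integrable_condDistrib (mβ := m) (T := id) (measurable_id'' hm) hX hf hfi

end

/-! ### From rational characteristic functions to weak convergence -/

/-- The integrands differ by at most `|s - t| |x|`, and `|x| ≤ 1 + x²`. A common second moment bound
thus makes a family of characteristic functions equi-Lipschitz, so rational points suffice. -/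
theorem norm_charFun_sub_le {μ : Measure ℝ} [IsProbabilityMeasure μ] {C : ℝ}
    (hi : Integrable (fun x => x ^ 2) μ) (hC : ∫ x, x ^ 2 ∂μ ≤ C) (s t : ℝ) :
    ‖charFun μ s - charFun μ t‖ ≤ |s - t| * (1 + C) := by
  have hint : ∀ r : ℝ, Integrable (fun x : ℝ => Complex.exp (r * x * Complex.I)) μ := by
    intro r
    refine Integrable.of_bound (C := 1) (by fun_prop) (ae_of_all _ fun x => ?_)
    rw [← Complex.ofReal_mul, Complex.norm_exp_ofReal_mul_I]
  rw [charFun_apply_real, charFun_apply_real, ← integral_sub (hint s) (hint t)]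
  have hb : ∀ x : ℝ, ‖Complex.exp (s * x * Complex.I) - Complex.exp (t * x * Complex.I)‖
      ≤ |s - t| * (1 + x ^ 2) := by
    intro x
    have h1 : Complex.exp (s * x * Complex.I) - Complex.exp (t * x * Complex.I)
        = Complex.exp ((t * x : ℝ) * Complex.I) *
          (Complex.exp (Complex.I * ((s - t) * x : ℝ)) - 1) := by
      rw [mul_sub, ← Complex.exp_add]
      push_cast
      ring_nf
    rw [h1, norm_mul, Complex.norm_exp_ofReal_mul_I, one_mul]
    refine Real.norm_exp_I_mul_ofReal_sub_one_le.trans ?_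
    rw [Real.norm_eq_abs, abs_mul]
    refine mul_le_mul_of_nonneg_left ?_ (abs_nonneg _)
    nlinarith [sq_nonneg (|x| - 1), sq_abs x, abs_nonneg x]
  calc _ ≤ ∫ x, ‖Complex.exp (s * x * Complex.I) - Complex.exp (t * x * Complex.I)‖ ∂μ :=
        norm_integral_le_integral_norm _
    _ ≤ ∫ x, |s - t| * (1 + x ^ 2) ∂μ :=
        integral_mono ((hint s).sub (hint t)).norm
          (((integrable_const 1).add hi).const_mul _) hb
    _ = |s - t| * (1 + ∫ x, x ^ 2 ∂μ) := by
        rw [integral_const_mul, integral_add (integrable_const 1) hi]; simp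
    _ ≤ _ := mul_le_mul_of_nonneg_left (by linarith) (abs_nonneg _)

/-- A variant of Lévy's continuity theorem which tests the characteristic functions at rational
points, for measures with eventually bounded second moments. -/
theorem tendsto_of_tendsto_charFun_rat {μ : ℕ → ProbabilityMeasure ℝ} {μ₀ : ProbabilityMeasure ℝ}
    {C : ℝ} (hi : ∀ n, Integrable (fun x => x ^ 2) (μ n : Measure ℝ))
    (hC : ∀ᶠ n in atTop, ∫ x, x ^ 2 ∂(μ n : Measure ℝ) ≤ C)
    (h : ∀ q : ℚ, Tendsto (fun n => charFun (μ n : Measure ℝ) (q : ℝ)) atTop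
      (𝓝 (charFun (μ₀ : Measure ℝ) (q : ℝ)))) :
    Tendsto μ atTop (𝓝 μ₀) := by
  refine ProbabilityMeasure.tendsto_of_tendsto_charFun fun t => ?_
  have hC0 : 0 ≤ C := by
    obtain ⟨n, hn⟩ := hC.exists
    exact (integral_nonneg fun x => sq_nonneg x).trans hn
  rw [Metric.tendsto_nhds]
  intro ε hε
  have hcont : ContinuousAt (charFun (μ₀ : Measure ℝ)) t := by
    have : Continuous (charFun (μ₀ : Measure ℝ)) := by fun_prop
    exact this.continuousAt
  obtain ⟨η, hη, hη'⟩ := Metric.continuousAt_iff.1 hcont (ε / 3) (by positivity)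
  set r := min η (ε / (3 * (1 + C))) with hr
  have hr0 : 0 < r := lt_min hη (by positivity)
  obtain ⟨q, hq1, hq2⟩ := exists_rat_btwn (show t < t + r by linarith)
  have hqt : |(q : ℝ) - t| < r := by rw [abs_of_pos (by linarith)]; linarith
  have hd0 : dist (charFun (μ₀ : Measure ℝ) (q : ℝ)) (charFun (μ₀ : Measure ℝ) t) < ε / 3 :=
    hη' (by rw [Real.dist_eq]; exact hqt.trans_le (min_le_left _ _))
  filter_upwards [hC, (Metric.tendsto_nhds.1 (h q)) (ε / 3) (by positivity)] with n h1 h2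
  have h3 : dist (charFun (μ n : Measure ℝ) t) (charFun (μ n : Measure ℝ) (q : ℝ)) < ε / 3 := by
    rw [dist_comm, dist_eq_norm]
    refine (norm_charFun_sub_le (hi n) h1 _ _).trans_lt ?_
    have : |(q : ℝ) - t| < ε / (3 * (1 + C)) := hqt.trans_le (min_le_right _ _)
    calc |(q : ℝ) - t| * (1 + C) < ε / (3 * (1 + C)) * (1 + C) :=
          mul_lt_mul_of_pos_right this (by positivity)
      _ = ε / 3 := by field_simp
  calc _ ≤ dist (charFun (μ n : Measure ℝ) t) (charFun (μ n : Measure ℝ) (q : ℝ))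
        + dist (charFun (μ n : Measure ℝ) (q : ℝ)) (charFun (μ₀ : Measure ℝ) (q : ℝ))
        + dist (charFun (μ₀ : Measure ℝ) (q : ℝ)) (charFun (μ₀ : Measure ℝ) t) :=
        dist_triangle4 _ _ _ _
    _ < ε := by linarith

theorem measurable_centeredGaussianKernel {Ω : Type*} [MeasurableSpace Ω] {v : Ω → ℝ}
    (hv : Measurable v) :
    Measurable fun ω => (centeredGaussianKernel v ω : Measure ℝ) :=
  measurable_gaussianReal.comp (measurable_const.prodMk hv.real_toNNReal)

/-- The almost sure conditional central limit theorem for the tails of a bounded martingale. -/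
theorem BoundedIncrements.almostSureCondConvergence {Ω : Type*} [m0 : MeasurableSpace Ω]
    {P : Measure Ω} [IsProbabilityMeasure P] {ℱ : Filtration ℕ m0} {α : ℕ → ℝ}
    {M D v : ℕ → Ω → ℝ} {K : ℝ} {M' v' : Ω → ℝ} (h : BoundedIncrements P ℱ α M D v K)
    (hα : Summable fun n => α n ^ 2) (hM' : Measurable M') (hv' : Measurable v')
    (hM : ∀ᵐ ω ∂P, Tendsto (fun n => M n ω) atTop (𝓝 (M' ω)))
    (hv : ∀ᵐ ω ∂P, Tendsto (fun n => v n ω) atTop (𝓝 (v' ω)))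
    {b d : ℕ → ℝ} (hb : ∀ᶠ n in atTop, 0 ≤ b n) (hd : Tendsto d atTop (𝓝 0))
    (hbd : ∀ᶠ n in atTop, ∀ j, b n * α (n + j + 1) ^ 2 ≤ d n)
    (htail : Tendsto (fun n => b n * ∑' j, α (n + j + 1) ^ 2) atTop (𝓝 1)) :
    AlmostSureCondConvergence P (fun n => ℱ n) (fun n ω => √(b n) * (M n ω - M' ω))
      (centeredGaussianKernel v') := by
  have hMm : ∀ n, Measurable (M n) := fun n => (h.meas n).mono (ℱ.le _) le_rfl
  set X : ℕ → Ω → ℝ := fun n ω => √(b n) * (M n ω - M' ω) with hX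
  have hXm : ∀ n, Measurable (X n) := fun n => ((hMm n).sub hM').const_mul _
  refine ⟨measurable_centeredGaussianKernel hv', fun n => condLaw P (ℱ n) (X n),
    fun n => isRegularCondDistrib_condLaw (ℱ.le n) (hXm n), ?_⟩
  have hM'K : ∀ᵐ ω ∂P, |M' ω| ≤ K := by
    filter_upwards [hM] with ω hω
    exact le_of_tendsto hω.abs (Eventually.of_forall fun n => h.abs_mart_le n ω)
  have hX2i : ∀ n, Integrable (fun ω => X n ω ^ 2) P := by
    intro n
    refine Integrable.of_bound (C := (√(b n) * (2 * K)) ^ 2)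
      ((hXm n).pow_const 2).aestronglyMeasurable ?_
    filter_upwards [hM'K] with ω hω
    rw [norm_pow]
    refine pow_le_pow_left₀ (norm_nonneg _) ?_ 2
    simp only [hX]
    rw [norm_mul, Real.norm_eq_abs, abs_of_nonneg (Real.sqrt_nonneg _)]
    refine mul_le_mul_of_nonneg_left ?_ (Real.sqrt_nonneg _)
    exact (abs_sub _ _).trans (by linarith [h.abs_mart_le n ω])
  have hsq : ∀ᵐ ω ∂P, ∀ n, Integrable (fun x => x ^ 2) (condLaw P (ℱ n) (X n) ω : Measure ℝ) :=
    ae_all_iff.2 fun n => ae_integrable_condLaw (f := fun x : ℝ => x ^ 2) (ℱ.le n) (hXm n)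
      (by fun_prop) (hX2i n)
  have hmom : ∀ᵐ ω ∂P, ∀ n, 0 ≤ b n → ∫ x, x ^ 2 ∂(condLaw P (ℱ n) (X n) ω : Measure ℝ)
      ≤ K ^ 2 * (b n * ∑' j, α (n + j + 1) ^ 2) := by
    refine ae_all_iff.2 fun n => ?_
    by_cases hbn : 0 ≤ b n
    swap
    · exact ae_of_all _ fun ω h => absurd h hbn
    have hi : Integrable (fun ω => (M n ω - M' ω) ^ 2) P := by
      refine Integrable.of_bound (C := (2 * K) ^ 2)
        (((hMm n).sub hM').pow_const 2).aestronglyMeasurable ?_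
      filter_upwards [hM'K] with ω hω
      rw [norm_pow]
      exact pow_le_pow_left₀ (norm_nonneg _)
        ((abs_sub _ _).trans (by linarith [h.abs_mart_le n ω])) 2
    have he : (fun ω => X n ω ^ 2) = b n • fun ω => (M n ω - M' ω) ^ 2 := by
      funext ω
      simp only [hX, Pi.smul_apply, smul_eq_mul]
      rw [mul_pow, Real.sq_sqrt hbn]
    filter_upwards [condExp_comp_ae_eq_integral_condLaw (f := fun x : ℝ => x ^ 2) (ℱ.le n) (hXm n)
      (by fun_prop) (hX2i n), h.condExp_sq_le hα hM n,
      condExp_smul (μ := P) (b n) (fun ω => (M n ω - M' ω) ^ 2) (ℱ n)] with ω h1 h2 h3 _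
    rw [← h1, he, h3, Pi.smul_apply, smul_eq_mul]
    calc _ ≤ b n * (K ^ 2 * ∑' j, α (n + j + 1) ^ 2) := mul_le_mul_of_nonneg_left h2 hbn
      _ = _ := by ring
  have hchar : ∀ᵐ ω ∂P, ∀ q : ℚ, ∀ n, (P[fun ω =>
      Complex.exp (((q : ℝ) * X n ω : ℝ) * Complex.I) | ℱ n]) ω
        = charFun (condLaw P (ℱ n) (X n) ω : Measure ℝ) (q : ℝ) := by
    refine ae_all_iff.2 fun q => ae_all_iff.2 fun n => ?_
    have := condExp_comp_ae_eq_integral_condLaw (P := P)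
      (f := fun x : ℝ => Complex.exp (((q : ℝ) * x : ℝ) * Complex.I)) (ℱ.le n) (hXm n)
      (Continuous.stronglyMeasurable (by fun_prop)) (by
        refine Integrable.of_bound (C := 1) ?_ (ae_of_all _ fun ω => ?_)
        · have := hXm n
          exact Measurable.aestronglyMeasurable (by fun_prop)
        · rw [Complex.norm_exp_ofReal_mul_I])
    filter_upwards [this] with ω hω
    rw [hω, charFun_apply_real]
    simp
  -- Countably many `q` leave a single null set.
  have hclt := ae_all_iff.2 fun q : ℚ => h.ae_tendsto_condExp_cexp hα hM' hM hv hb hd hbd htail q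
  filter_upwards [hsq, hmom, hchar, hclt, hv] with ω h1 h2 h3 h4 h5
  have hv0 : 0 ≤ v' ω := ge_of_tendsto' h5 fun n => h.var_nonneg n ω
  refine tendsto_of_tendsto_charFun_rat (C := K ^ 2 * 2) h1 ?_ fun q => ?_
  · filter_upwards [hb, htail.eventually (gt_mem_nhds (show (1 : ℝ) < 2 by norm_num))] with n h6 h7
    exact (h2 n h6).trans (mul_le_mul_of_nonneg_left h7.le (sq_nonneg _))
  · have hG : charFun (centeredGaussianKernel v' ω : Measure ℝ) (q : ℝ)
        = (Real.exp (-((q : ℝ) ^ 2 / 2 * v' ω)) : ℂ) := by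
      change charFun (gaussianReal 0 (v' ω).toNNReal) (q : ℝ) = _
      rw [charFun_gaussianReal]
      simp only [Complex.ofReal_zero, mul_zero, zero_mul, zero_sub, Complex.ofReal_exp]
      rw [Real.coe_toNNReal _ hv0]
      push_cast
      ring_nf
    rw [hG]
    exact (h4 q).congr fun n => h3 q n

/-! ### Conditional expectations from conditional densities -/

/-- The hypothesis identifies the conditional probabilities only up to a null set depending on `B`.
This suffices to identify the joint law of `(T, Y)` on rectangles, and uniqueness of disintegrations
then gives equality of measures outside one null set. -/
theorem condDistrib_ae_eq_withDensity {Ω β : Type*} {m0 : MeasurableSpace Ω}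
    {mβ : MeasurableSpace β} {P : Measure Ω} [IsProbabilityMeasure P] {T : Ω → β} {Y : Ω → ℝ}
    (hT : Measurable T) (hY : Measurable Y) {ρ : β → ℝ → ℝ}
    (hρ : Measurable (Function.uncurry ρ)) (hρ0 : ∀ t y, 0 ≤ ρ t y)
    (hρ1 : ∀ t, ∫ y, ρ t y = 1)
    (h : ∀ B : Set ℝ, MeasurableSet B →
      P⟦Y ⁻¹' B | mβ.comap T⟧ =ᵐ[P] fun ω => ∫ y in B, ρ (T ω) y) :
    ∀ᵐ ω ∂P, condDistrib Y T P (T ω) = volume.withDensity fun y => ENNReal.ofReal (ρ (T ω) y) := by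
  -- The integral of a nonintegrable function is 0 by convention, so total mass 1 forces
  -- integrability.
  have hρi : ∀ t, Integrable (ρ t) := fun t =>
    not_imp_comm.1 integral_undef (by rw [hρ1]; exact one_ne_zero)
  have hρm : Measurable (Function.uncurry fun t y => ENNReal.ofReal (ρ t y)) :=
    hρ.ennreal_ofReal
  set κ : Kernel β ℝ := Kernel.withDensity (Kernel.const β volume) fun t y => ENNReal.ofReal (ρ t y)
    with hκ
  have hκa : ∀ t, κ t = volume.withDensity fun y => ENNReal.ofReal (ρ t y) := fun t => by
    rw [hκ, Kernel.withDensity_apply _ hρm, Kernel.const_apply]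
  have hκr : ∀ t {B : Set ℝ}, MeasurableSet B → κ t B = ENNReal.ofReal (∫ y in B, ρ t y) := by
    intro t B hB
    rw [hκa, withDensity_apply _ hB, ofReal_integral_eq_lintegral_ofReal (hρi t).integrableOn
      (ae_of_all _ (hρ0 t))]
  have hmk : IsMarkovKernel κ := ⟨fun t => ⟨by
    rw [hκr t MeasurableSet.univ, Measure.restrict_univ, hρ1, ENNReal.ofReal_one]⟩⟩
  have hBeq : ∀ B : Set ℝ, MeasurableSet B → ∀ᵐ ω ∂P, condDistrib Y T P (T ω) B = κ (T ω) B := by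
    intro B hB
    filter_upwards [condDistrib_ae_eq_condExp (μ := P) hT hY hB, h B hB] with ω h1 h2
    rw [hκr _ hB, ← h2, ← h1, ofReal_measureReal]
  have hmap : P.map (fun ω => (T ω, Y ω)) = P.map T ⊗ₘ κ := by
    refine Measure.ext_prod_iff.2 fun {A B} hA hB => ?_
    rw [Measure.map_apply (hT.prodMk hY) (hA.prod hB), Measure.compProd_apply_prod hA hB,
      setLIntegral_map hA (κ.measurable_coe hB) hT,
      show (fun ω => (T ω, Y ω)) ⁻¹' A ×ˢ B = T ⁻¹' A ∩ Y ⁻¹' B from rfl,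
      ← setLIntegral_preimage_condDistrib hT hY.aemeasurable hB hA]
    exact lintegral_congr_ae (ae_restrict_of_ae (hBeq B hB))
  have := condDistrib_ae_eq_of_measure_eq_compProd_of_measurable hT hY hmap
  filter_upwards [ae_of_ae_map hT.aemeasurable this] with ω hω
  rw [hω, hκa]

theorem condExp_ae_eq_integral_mul_density {Ω β : Type*} {m0 : MeasurableSpace Ω}
    {mβ : MeasurableSpace β} {P : Measure Ω} [IsProbabilityMeasure P] {T : Ω → β} {Y : Ω → ℝ}
    (hT : Measurable T) (hY : Measurable Y) {ρ : β → ℝ → ℝ}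
    (hρ : Measurable (Function.uncurry ρ)) (hρ0 : ∀ t y, 0 ≤ ρ t y)
    (hρ1 : ∀ t, ∫ y, ρ t y = 1)
    (h : ∀ B : Set ℝ, MeasurableSet B →
      P⟦Y ⁻¹' B | mβ.comap T⟧ =ᵐ[P] fun ω => ∫ y in B, ρ (T ω) y)
    {F : β × ℝ → ℝ} (hF : Measurable F) (hFi : Integrable (fun ω => F (T ω, Y ω)) P) :
    P[fun ω => F (T ω, Y ω) | mβ.comap T] =ᵐ[P] fun ω => ∫ y, F (T ω, y) * ρ (T ω) y := by
  filter_upwards [condExp_prod_ae_eq_integral_condDistrib hT hY.aemeasurable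
    hF.stronglyMeasurable hFi, condDistrib_ae_eq_withDensity hT hY hρ hρ0 hρ1 h] with ω h1 h2
  have hρω : Measurable (ρ (T ω)) := hρ.comp measurable_prodMk_left
  rw [h1, h2, integral_withDensity_eq_integral_toReal_smul hρω.ennreal_ofReal
    (ae_of_all _ fun y => ENNReal.ofReal_lt_top)]
  refine integral_congr_ae (ae_of_all _ fun y => ?_)
  simp only [smul_eq_mul]
  rw [ENNReal.toReal_ofReal (hρ0 _ _), mul_comm]

/-! ### Families of positive densities -/

/-- A family of strictly positive probability densities. -/
structure PosDensities {Θ : Type*} (kt : Θ → ℝ → ℝ) : Prop where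
  pos : ∀ θ y, 0 < kt θ y
  meas : ∀ θ, Measurable (kt θ)
  integral : ∀ θ, ∫ y, kt θ y = 1

theorem PosDensities.integrable {Θ : Type*} {kt : Θ → ℝ → ℝ} (hkt : PosDensities kt) (θ : Θ) :
    Integrable (kt θ) :=
  not_imp_comm.1 integral_undef (by rw [hkt.integral]; exact one_ne_zero)

theorem ModelAssumptions.posDensities_noisyKernel {Θ : Type*} [Fintype Θ] {k : Θ → ℝ → ℝ}
    {fZ : ℝ → ℝ} {g0 : Θ → ℝ} (h : ModelAssumptions k fZ g0) :
    PosDensities (noisyKernel k fZ) := by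
  have hki : ∀ θ, Integrable (k θ) := fun θ =>
    not_imp_comm.1 integral_undef (by rw [h.k_integral]; exact one_ne_zero)
  have hzi : Integrable fZ :=
    not_imp_comm.1 integral_undef (by rw [h.fZ_integral]; exact one_ne_zero)
  have hkc : ∀ θ, Continuous (k θ) := fun θ => (h.k_contDiff θ).continuous
  have hzc : Continuous fZ := h.fZ_uniformContinuous.continuous
  obtain ⟨C, hC⟩ := h.k_bounded
  have heq : ∀ θ y, noisyKernel k fZ θ y = ∫ t, fZ t * k θ (y - t) := fun θ y => by
    simp [noisyKernel, convolution_def]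
  refine ⟨fun θ y => ?_, fun θ => ?_, fun θ => ?_⟩
  · rw [heq]
    have hi : Integrable fun t => fZ t * k θ (y - t) := by
      refine hzi.mul_bdd (c := C) ?_ (ae_of_all _ fun t => ?_)
      · exact ((hkc θ).comp (continuous_const.sub continuous_id)).aestronglyMeasurable
      · rw [Real.norm_eq_abs, abs_of_pos (h.k_pos _ _)]; exact hC _ _
    refine (integral_pos_iff_support_of_nonneg
      (fun t => (mul_pos (h.fZ_pos t) (h.k_pos θ _)).le) hi).2 ?_
    have : (Function.support fun t => fZ t * k θ (y - t)) = Set.univ :=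
      Set.eq_univ_of_forall fun t => (mul_pos (h.fZ_pos t) (h.k_pos θ _)).ne'
    rw [this]
    simp
  · have hsm : StronglyMeasurable (fun p : ℝ × ℝ => fZ p.2 * k θ (p.1 - p.2)) := by
      have := hkc θ
      exact Continuous.stronglyMeasurable (by fun_prop)
    rw [show noisyKernel k fZ θ = fun y => ∫ t, fZ t * k θ (y - t) from funext (heq θ)]
    exact (hsm.integral_prod_right' (ν := (volume : Measure ℝ))).measurable
  · have := integral_convolution (ContinuousLinearMap.mul ℝ ℝ) (μ := volume) (ν := volume)
      hzi (hki θ)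
    rw [h.fZ_integral, h.k_integral] at this
    simpa [noisyKernel] using this

section

variable {Θ : Type*} [Fintype Θ] {kt k : Θ → ℝ → ℝ} {g : Θ → ℝ}

theorem measurable_mixture (hkt : PosDensities kt) :
    Measurable fun p : (Θ → ℝ) × ℝ => mixture kt p.1 p.2 := by
  have := hkt.meas
  unfold mixture
  fun_prop

theorem measurable_posterior (hkt : PosDensities kt) (θ : Θ) :
    Measurable fun p : (Θ → ℝ) × ℝ => posterior kt p.1 p.2 θ := by
  have := hkt.meas θ
  have h2 := measurable_mixture hkt
  unfold posterior
  fun_prop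

theorem exists_pos_of_mem_stdSimplex (hg : g ∈ stdSimplex ℝ Θ) : ∃ θ, 0 < g θ := by
  by_contra! hcon
  have := Finset.sum_nonpos fun θ (_ : θ ∈ Finset.univ) => hcon θ
  rw [hg.2] at this
  linarith

theorem mixture_pos (hkt : PosDensities kt) (hg : g ∈ stdSimplex ℝ Θ) (y : ℝ) :
    0 < mixture kt g y := by
  obtain ⟨θ, hθ⟩ := exists_pos_of_mem_stdSimplex hg
  exact Finset.sum_pos' (fun θ _ => mul_nonneg (hkt.pos θ y).le (hg.1 θ))
    ⟨θ, Finset.mem_univ _, mul_pos (hkt.pos θ y) hθ⟩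

theorem integrable_mixture (hkt : PosDensities kt) (g : Θ → ℝ) : Integrable (mixture kt g) :=
  integrable_finsetSum _ fun θ _ => (hkt.integrable θ).mul_const (g θ)

theorem integral_mixture (hkt : PosDensities kt) (hg : g ∈ stdSimplex ℝ Θ) :
    ∫ y, mixture kt g y = 1 := by
  unfold mixture
  rw [integral_finsetSum _ fun θ _ => (hkt.integrable θ).mul_const (g θ)]
  simp_rw [integral_mul_const, hkt.integral, one_mul]
  exact hg.2

theorem posterior_mul_mixture (hkt : PosDensities kt) (hg : g ∈ stdSimplex ℝ Θ) (y : ℝ) (θ : Θ) :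
    posterior kt g y θ * mixture kt g y = kt θ y * g θ :=
  div_mul_cancel₀ _ (mixture_pos hkt hg y).ne'

theorem posterior_mem_stdSimplex (hkt : PosDensities kt) (hg : g ∈ stdSimplex ℝ Θ) (y : ℝ) :
    posterior kt g y ∈ stdSimplex ℝ Θ := by
  refine ⟨fun θ => div_nonneg (mul_nonneg (hkt.pos θ y).le (hg.1 θ)) (mixture_pos hkt hg y).le, ?_⟩
  unfold posterior
  rw [← Finset.sum_div]
  exact div_self (mixture_pos hkt hg y).ne'

theorem mixture_nonneg {x : ℝ} (hk : ∀ θ, 0 ≤ k θ x) (hg : g ∈ stdSimplex ℝ Θ) :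
    0 ≤ mixture k g x :=
  Finset.sum_nonneg fun θ _ => mul_nonneg (hk θ) (hg.1 θ)

theorem mixture_le {C x : ℝ} (hC : ∀ θ, k θ x ≤ C) (hg : g ∈ stdSimplex ℝ Θ) :
    mixture k g x ≤ C := by
  calc mixture k g x ≤ ∑ θ, C * g θ :=
        Finset.sum_le_sum fun θ _ => mul_le_mul_of_nonneg_right (hC θ) (hg.1 θ)
    _ = C := by rw [← Finset.mul_sum, hg.2, mul_one]

theorem tendsto_mixture {ι : Type*} {l : Filter ι} {u : ι → Θ → ℝ} (hu : Tendsto u l (𝓝 g))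
    (x : ℝ) : Tendsto (fun i => mixture k (u i) x) l (𝓝 (mixture k g x)) :=
  tendsto_finsetSum _ fun θ _ => (tendsto_pi_nhds.1 hu θ).const_mul _

theorem tendsto_posterior {ι : Type*} {l : Filter ι} {u : ι → Θ → ℝ} (hkt : PosDensities kt)
    (hg : g ∈ stdSimplex ℝ Θ) (hu : Tendsto u l (𝓝 g)) (y : ℝ) :
    Tendsto (fun i => posterior kt (u i) y) l (𝓝 (posterior kt g y)) :=
  tendsto_pi_nhds.2 fun θ => ((tendsto_pi_nhds.1 hu θ).const_mul _).div (tendsto_mixture hu y)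
    (mixture_pos hkt hg y).ne'

end

/-! ### The asymptotic variance -/

section

variable {Θ : Type*} [Fintype Θ] {k : Θ → ℝ → ℝ} {fZ : ℝ → ℝ} {g : Θ → ℝ} {x C : ℝ}

/-- The increment `f(x ∣ y) - f(x)`, as a function of the mixing and of `y`. -/
noncomputable def mixtureIncrement (k : Θ → ℝ → ℝ) (fZ : ℝ → ℝ) (x : ℝ) (p : (Θ → ℝ) × ℝ) : ℝ :=
  condMixture k fZ p.1 x p.2 - mixture k p.1 x

theorem measurable_mixtureIncrement (hkt : PosDensities (noisyKernel k fZ)) (x : ℝ) :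
    Measurable (mixtureIncrement k fZ x) := by
  have := fun θ => measurable_posterior hkt θ
  unfold mixtureIncrement condMixture mixture
  fun_prop

theorem abs_mixtureIncrement_le (hkt : PosDensities (noisyKernel k fZ)) (hk : ∀ θ, 0 ≤ k θ x)
    (hC : ∀ θ, k θ x ≤ C) (hg : g ∈ stdSimplex ℝ Θ) (y : ℝ) :
    |mixtureIncrement k fZ x (g, y)| ≤ C := by
  have hp := posterior_mem_stdSimplex hkt hg y
  unfold mixtureIncrement condMixture
  rw [abs_le]
  constructor <;>
    linarith [mixture_nonneg hk hg, mixture_le hC hg, mixture_nonneg hk hp, mixture_le hC hp]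

/-- By Bayes' rule, posterior times predictive density is `k̃(y ∣ θ) g(θ)`, which integrates to
`g(θ)`. This is the martingale property of the mixtures. -/
theorem integral_mixtureIncrement_mul (hkt : PosDensities (noisyKernel k fZ))
    (hg : g ∈ stdSimplex ℝ Θ) (x : ℝ) :
    ∫ y, mixtureIncrement k fZ x (g, y) * mixture (noisyKernel k fZ) g y = 0 := by
  have : ∀ y, mixtureIncrement k fZ x (g, y) * mixture (noisyKernel k fZ) g y
      = ∑ θ, k θ x * (noisyKernel k fZ θ y * g θ)
        - mixture k g x * mixture (noisyKernel k fZ) g y := by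
    intro y
    simp only [mixtureIncrement, condMixture]
    rw [sub_mul]
    congr 1
    rw [mixture, Finset.sum_mul]
    refine Finset.sum_congr rfl fun θ _ => ?_
    rw [mul_assoc, posterior_mul_mixture hkt hg]
  have hi : ∀ θ, Integrable fun y => k θ x * (noisyKernel k fZ θ y * g θ) := fun θ =>
    ((hkt.integrable θ).mul_const _).const_mul _
  simp_rw [this]
  rw [integral_sub (integrable_finsetSum _ fun θ _ => hi θ)
    ((integrable_mixture hkt g).const_mul _), integral_const_mul, integral_mixture hkt hg,
    integral_finsetSum _ fun θ _ => hi θ]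
  simp_rw [integral_const_mul, integral_mul_const, hkt.integral]
  simp [mixture]

theorem asympVariance_eq (k : Θ → ℝ → ℝ) (fZ : ℝ → ℝ) (g : Θ → ℝ) (x : ℝ) :
    asympVariance k fZ g x =
      ∫ y, mixtureIncrement k fZ x (g, y) ^ 2 * mixture (noisyKernel k fZ) g y := rfl

theorem measurable_asympVariance (hkt : PosDensities (noisyKernel k fZ)) (x : ℝ) :
    Measurable fun g : Θ → ℝ => asympVariance k fZ g x := by
  have : Measurable fun p : (Θ → ℝ) × ℝ =>
      mixtureIncrement k fZ x p ^ 2 * mixture (noisyKernel k fZ) p.1 p.2 :=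
    ((measurable_mixtureIncrement hkt x).pow_const 2).mul (measurable_mixture hkt)
  exact (this.stronglyMeasurable.integral_prod_right' (ν := (volume : Measure ℝ))).measurable

theorem asympVariance_nonneg (hkt : PosDensities (noisyKernel k fZ)) (hg : g ∈ stdSimplex ℝ Θ)
    (x : ℝ) : 0 ≤ asympVariance k fZ g x :=
  integral_nonneg fun y => mul_nonneg (sq_nonneg _) (mixture_pos hkt hg y).le

theorem asympVariance_le (hkt : PosDensities (noisyKernel k fZ)) (hk : ∀ θ, 0 ≤ k θ x)
    (hC : ∀ θ, k θ x ≤ C) (hg : g ∈ stdSimplex ℝ Θ) : asympVariance k fZ g x ≤ C ^ 2 := by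
  rw [asympVariance_eq]
  have hsq : ∀ y, mixtureIncrement k fZ x (g, y) ^ 2 ≤ C ^ 2 := fun y =>
    sq_le_sq' (abs_le.1 (abs_mixtureIncrement_le hkt hk hC hg y)).1
      (abs_le.1 (abs_mixtureIncrement_le hkt hk hC hg y)).2
  calc _ ≤ ∫ y, C ^ 2 * mixture (noisyKernel k fZ) g y :=
        integral_mono_of_nonneg
          (ae_of_all _ fun y => mul_nonneg (sq_nonneg _) (mixture_pos hkt hg y).le)
          ((integrable_mixture hkt g).const_mul _)
          (ae_of_all _ fun y => mul_le_mul_of_nonneg_right (hsq y) (mixture_pos hkt hg y).le)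
    _ = C ^ 2 := by rw [integral_const_mul, integral_mixture hkt hg, mul_one]

/-- The integrands converge pointwise and are dominated by `C² ∑ k̃(y ∣ θ)`, because masses are at
most 1. -/
theorem tendsto_asympVariance (hkt : PosDensities (noisyKernel k fZ)) (hk : ∀ θ, 0 ≤ k θ x)
    (hC : ∀ θ, k θ x ≤ C) (hg : g ∈ stdSimplex ℝ Θ) {u : ℕ → Θ → ℝ}
    (hus : ∀ n, u n ∈ stdSimplex ℝ Θ) (hu : Tendsto u atTop (𝓝 g)) :
    Tendsto (fun n => asympVariance k fZ (u n) x) atTop (𝓝 (asympVariance k fZ g x)) := by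
  simp_rw [asympVariance_eq]
  refine tendsto_integral_of_dominated_convergence
    (fun y => C ^ 2 * ∑ θ, noisyKernel k fZ θ y) (fun n => ?_)
    ((integrable_finsetSum _ fun θ _ => hkt.integrable θ).const_mul _)
    (fun n => ae_of_all _ fun y => ?_) (ae_of_all _ fun y => ?_)
  · exact ((((measurable_mixtureIncrement hkt x).comp measurable_prodMk_left).pow_const 2).mul
      ((measurable_mixture hkt).comp measurable_prodMk_left)).aestronglyMeasurable
  · rw [Real.norm_eq_abs,
      abs_of_nonneg (mul_nonneg (sq_nonneg _) (mixture_pos hkt (hus n) y).le)]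
    have h1 := abs_le.1 (abs_mixtureIncrement_le hkt hk hC (hus n) y)
    refine mul_le_mul (sq_le_sq' h1.1 h1.2) (Finset.sum_le_sum fun θ _ => ?_)
      (mixture_pos hkt (hus n) y).le (sq_nonneg _)
    have : u n θ ≤ 1 := (hus n).2 ▸
      Finset.single_le_sum (fun θ _ => (hus n).1 θ) (Finset.mem_univ θ)
    exact mul_le_of_le_one_right (hkt.pos θ y).le this
  · exact (((tendsto_mixture (tendsto_posterior hkt hg hu y) x).sub
      (tendsto_mixture hu x)).pow 2).mul (tendsto_mixture hu y)

end

/-! ### Newton's recursion as a bounded martingale -/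

section

variable {Θ Ω : Type*} [Fintype Θ] [m0 : MeasurableSpace Ω] {P : Measure Ω}
  {k kt : Θ → ℝ → ℝ} {fZ : ℝ → ℝ} {g0 : Θ → ℝ} {α : ℕ → ℝ} {Y : ℕ → Ω → ℝ}

/-- The filtration generated by the observations `Y 1, Y 2, …`. -/
def obsFiltration (hY : ∀ n, 1 ≤ n → Measurable (Y n)) : Filtration ℕ m0 where
  seq := obsSigma Y
  mono' _ _ hij := biSup_mono fun _ hi => Finset.mem_Icc.2
    ⟨(Finset.mem_Icc.1 hi).1, (Finset.mem_Icc.1 hi).2.trans hij⟩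
  le' _ := iSup₂_le fun i hi => (hY i (Finset.mem_Icc.1 hi).1).comap_le

omit m0 in
theorem newton_mem_stdSimplex (hkt : PosDensities kt) (hα : LearningRate α)
    (hg0 : g0 ∈ stdSimplex ℝ Θ) (n : ℕ) (ω : Ω) : newton kt α g0 Y n ω ∈ stdSimplex ℝ Θ := by
  induction n with
  | zero => exact hg0
  | succ n ih =>
    exact convex_stdSimplex ℝ Θ ih (posterior_mem_stdSimplex hkt ih (Y (n + 1) ω))
      (sub_nonneg.2 (hα.lt_one _ (Nat.le_add_left 1 n)).le) (hα.pos _ (Nat.le_add_left 1 n)).le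
      (sub_add_cancel _ _)

omit m0 in
theorem measurable_newton (hkt : PosDensities kt) (n : ℕ) :
    Measurable[obsSigma Y n] (newton kt α g0 Y n) := by
  induction n with
  | zero => exact measurable_const
  | succ n ih =>
    have h1 : Measurable[obsSigma Y (n + 1)] (newton kt α g0 Y n) := by
      refine ih.mono (biSup_mono fun _ hi => Finset.mem_Icc.2 ?_) le_rfl
      exact ⟨(Finset.mem_Icc.1 hi).1, (Finset.mem_Icc.1 hi).2.trans n.le_succ⟩
    have h2 : Measurable[obsSigma Y (n + 1)] (Y (n + 1)) :=
      Measurable.of_comap_le (le_iSup₂_of_le (n + 1)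
        (Finset.mem_Icc.2 ⟨Nat.le_add_left 1 n, le_rfl⟩) le_rfl)
    refine @measurable_pi_lambda _ _ _ (obsSigma Y (n + 1)) _ _ fun θ => ?_
    have h3 := (measurable_posterior hkt θ).comp (h1.prodMk h2)
    exact (((measurable_pi_apply θ).comp h1).const_mul _).add (h3.const_mul _)

/-- The current mixing is known given `obsSigma Y n`, so it is frozen while the next observation is
integrated against its predictive density. -/
theorem condExp_newton_obs [IsProbabilityMeasure P] (hkt : PosDensities (noisyKernel k fZ))
    (hα : LearningRate α) (hg0 : g0 ∈ stdSimplex ℝ Θ) (hY : IsLearningProcess P k fZ g0 α Y)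
    (n : ℕ) {F : (Θ → ℝ) × ℝ → ℝ} (hF : Measurable F) {C : ℝ}
    (hFC : ∀ g ∈ stdSimplex ℝ Θ, ∀ y, |F (g, y)| ≤ C) :
    P[fun ω => F (newton (noisyKernel k fZ) α g0 Y n ω, Y (n + 1) ω) | obsSigma Y n] =ᵐ[P]
      fun ω => ∫ y, F (newton (noisyKernel k fZ) α g0 Y n ω, y) *
        mixture (noisyKernel k fZ) (newton (noisyKernel k fZ) α g0 Y n ω) y := by
  set ν := newton (noisyKernel k fZ) α g0 Y n with hν
  have hle : obsSigma Y n ≤ m0 := (obsFiltration hY.measurable).le n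
  have hm : Measurable[obsSigma Y n] ν := measurable_newton hkt n
  have hs : ∀ ω, ν ω ∈ stdSimplex ℝ Θ := newton_mem_stdSimplex hkt hα hg0 n
  have hYm := hY.measurable (n + 1) (Nat.le_add_left 1 n)
  have hνp : @Measurable (Ω × ℝ) ((Θ → ℝ) × ℝ) (@Prod.instMeasurableSpace Ω ℝ (obsSigma Y n) _) _
      (fun p => (ν p.1, p.2)) :=
    (hm.comp (@measurable_fst Ω ℝ (obsSigma Y n) _)).prodMk (@measurable_snd Ω ℝ (obsSigma Y n) _)
  have := condExp_ae_eq_integral_mul_density (P := P) (mβ := obsSigma Y n) (T := id)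
    (ρ := fun ω y => mixture (noisyKernel k fZ) (ν ω) y) (F := fun p => F (ν p.1, p.2))
    (measurable_id'' hle) hYm ((measurable_mixture hkt).comp hνp)
    (fun ω y => (mixture_pos hkt (hs ω) y).le) (fun ω => integral_mixture hkt (hs ω))
    (by rw [MeasurableSpace.comap_id]; exact hY.condDensity n) (hF.comp hνp)
    (Integrable.of_bound (C := C)
      (hF.comp ((hm.mono hle le_rfl).prodMk hYm)).aestronglyMeasurable
      (ae_of_all _ fun ω => hFC _ (hs ω) _))
  rw [MeasurableSpace.comap_id] at this
  exact this

theorem martingale_newton [IsProbabilityMeasure P] (hkt : PosDensities (noisyKernel k fZ))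
    (hα : LearningRate α) (hg0 : g0 ∈ stdSimplex ℝ Θ) (hY : IsLearningProcess P k fZ g0 α Y)
    (θ : Θ) : Martingale (fun n ω => newton (noisyKernel k fZ) α g0 Y n ω θ)
      (obsFiltration hY.measurable) P := by
  have hs := newton_mem_stdSimplex (Y := Y) hkt hα hg0
  have hm : ∀ n, Measurable[obsSigma Y n] fun ω => newton (noisyKernel k fZ) α g0 Y n ω θ :=
    fun n => (measurable_pi_apply θ).comp (measurable_newton hkt n)
  have hle : ∀ n, obsSigma Y n ≤ m0 := (obsFiltration hY.measurable).le
  have hle1 : ∀ g ∈ stdSimplex ℝ Θ, |g θ| ≤ 1 := fun g hg => by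
    rw [abs_of_nonneg (hg.1 θ), ← hg.2]
    exact Finset.single_le_sum (fun θ _ => hg.1 θ) (Finset.mem_univ θ)
  have hi : ∀ n, Integrable (fun ω => newton (noisyKernel k fZ) α g0 Y n ω θ) P := fun n =>
    Integrable.of_bound (C := 1) ((hm n).mono (hle n) le_rfl).aestronglyMeasurable
      (ae_of_all _ fun ω => hle1 _ (hs n ω))
  refine martingale_nat (fun n => (hm n).stronglyMeasurable) hi fun n => ?_
  have hF : Measurable fun p : (Θ → ℝ) × ℝ =>
      (1 - α (n + 1)) * p.1 θ + α (n + 1) * posterior (noisyKernel k fZ) p.1 p.2 θ := by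
    have := measurable_posterior hkt θ
    fun_prop
  have := condExp_newton_obs (P := P) hkt hα hg0 hY n hF
    (C := |1 - α (n + 1)| + |α (n + 1)|) (fun g hg y => by
      refine (abs_add_le _ _).trans ?_
      rw [abs_mul, abs_mul]
      exact add_le_add (mul_le_of_le_one_right (abs_nonneg _) (hle1 g hg))
        (mul_le_of_le_one_right (abs_nonneg _) (hle1 _ (posterior_mem_stdSimplex hkt hg y))))
  refine EventuallyEq.symm (this.trans (ae_of_all _ fun ω => ?_))
  set g := newton (noisyKernel k fZ) α g0 Y n ω with hg
  have hgs : g ∈ stdSimplex ℝ Θ := hs n ω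
  have e : ∀ y, ((1 - α (n + 1)) * g θ + α (n + 1) * posterior (noisyKernel k fZ) g y θ)
      * mixture (noisyKernel k fZ) g y
      = (1 - α (n + 1)) * g θ * mixture (noisyKernel k fZ) g y
        + α (n + 1) * (noisyKernel k fZ θ y * g θ) := fun y => by
    rw [← posterior_mul_mixture hkt hgs]; ring
  refine (integral_congr_ae (ae_of_all _ e)).trans ?_
  rw [integral_add ((integrable_mixture hkt g).const_mul _)
    (((hkt.integrable θ).mul_const _).const_mul _), integral_const_mul, integral_const_mul,
    integral_mul_const, integral_mixture hkt hgs, hkt.integral]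
  ring

theorem exists_isLimitMixing [IsProbabilityMeasure P] (hkt : PosDensities (noisyKernel k fZ))
    (hα : LearningRate α) (hg0 : g0 ∈ stdSimplex ℝ Θ) (hY : IsLearningProcess P k fZ g0 α Y) :
    ∃ g : Ω → Θ → ℝ, IsLimitMixing P (newton (noisyKernel k fZ) α g0 Y) g := by
  classical
  have hs := newton_mem_stdSimplex (Y := Y) hkt hα hg0
  have hlim : ∀ᵐ ω ∂P, ∀ θ, ∃ c, Tendsto (fun n => newton (noisyKernel k fZ) α g0 Y n ω θ) atTop
      (𝓝 c) := by
    refine ae_all_iff.2 fun θ => ?_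
    refine (martingale_newton hkt hα hg0 hY θ).submartingale.exists_ae_tendsto_of_bdd
      (R := 1) fun n => ?_
    have : ∀ᵐ ω ∂P, ‖newton (noisyKernel k fZ) α g0 Y n ω θ‖ ≤ 1 := ae_of_all _ fun ω => by
      rw [Real.norm_eq_abs, abs_of_nonneg ((hs n ω).1 θ), ← (hs n ω).2]
      exact Finset.single_le_sum (fun θ _ => (hs n ω).1 θ) (Finset.mem_univ θ)
    simpa using eLpNorm_le_of_ae_bound (p := 1) this
  obtain ⟨G, hGm, hG⟩ := measurable_limit_of_tendsto_metrizable_ae (μ := P)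
    (f := fun n => newton (noisyKernel k fZ) α g0 Y n) (L := atTop)
    (fun n => ((measurable_newton hkt n).mono
      ((obsFiltration hY.measurable).le n) le_rfl).aemeasurable)
    (by
      filter_upwards [hlim] with ω hω
      choose c hc using hω
      exact ⟨c, tendsto_pi_nhds.2 hc⟩)
  have hcl : IsClosed (stdSimplex ℝ Θ) := isClosed_stdSimplex ℝ Θ
  -- The limit lies in the simplex only almost surely; `g0` replaces it elsewhere, so that
  -- membership holds for every `ω`.
  refine ⟨fun ω => if G ω ∈ stdSimplex ℝ Θ then G ω else g0, ?_, fun ω => ?_, ?_⟩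
  · exact Measurable.ite (hGm hcl.measurableSet) hGm measurable_const
  · split_ifs with h
    exacts [h, hg0]
  · filter_upwards [hG] with ω hω
    rw [if_pos (hcl.mem_of_tendsto hω (Eventually.of_forall fun n => hs n ω))]
    exact hω

theorem boundedIncrements_mixture [IsProbabilityMeasure P]
    (hkt : PosDensities (noisyKernel k fZ)) (hα : LearningRate α) (hg0 : g0 ∈ stdSimplex ℝ Θ)
    (hY : IsLearningProcess P k fZ g0 α Y) {x C : ℝ} (hk : ∀ θ, 0 ≤ k θ x)
    (hC : ∀ θ, k θ x ≤ C) :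
    BoundedIncrements P (obsFiltration hY.measurable) α
      (fun n ω => mixture k (newton (noisyKernel k fZ) α g0 Y n ω) x)
      (fun n ω => mixtureIncrement k fZ x (newton (noisyKernel k fZ) α g0 Y n ω, Y (n + 1) ω))
      (fun n ω => asympVariance k fZ (newton (noisyKernel k fZ) α g0 Y n ω) x) C where
  step n ω := by
    simp only [mixture, mixtureIncrement, condMixture, newton]
    rw [← Finset.sum_sub_distrib, Finset.mul_sum, ← Finset.sum_add_distrib]
    exact Finset.sum_congr rfl fun θ _ => by ring
  meas n := by
    have : Measurable fun g : Θ → ℝ => mixture k g x := by unfold mixture; fun_prop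
    exact this.comp (measurable_newton hkt n)
  meas_incr n := (measurable_mixtureIncrement hkt x).comp
    (((measurable_newton hkt n).mono ((obsFiltration hY.measurable).le n) le_rfl).prodMk
      (hY.measurable (n + 1) (Nat.le_add_left 1 n)))
  meas_var n := (measurable_asympVariance hkt x).comp (measurable_newton hkt n)
  abs_mart_le n ω := by
    have hs := newton_mem_stdSimplex (Y := Y) hkt hα hg0 n ω
    rw [abs_of_nonneg (mixture_nonneg hk hs)]
    exact mixture_le hC hs
  abs_incr_le n ω :=
    abs_mixtureIncrement_le hkt hk hC (newton_mem_stdSimplex hkt hα hg0 n ω) _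
  var_nonneg n ω := asympVariance_nonneg hkt (newton_mem_stdSimplex hkt hα hg0 n ω) x
  var_le n ω := asympVariance_le hkt hk hC (newton_mem_stdSimplex hkt hα hg0 n ω)
  condExp_incr n := by
    refine (condExp_newton_obs hkt hα hg0 hY n (measurable_mixtureIncrement hkt x)
      (fun g hg y => abs_mixtureIncrement_le hkt hk hC hg y)).trans (ae_of_all _ fun ω => ?_)
    exact integral_mixtureIncrement_mul hkt (newton_mem_stdSimplex hkt hα hg0 n ω) x
  condExp_incr_sq n := by
    refine condExp_newton_obs hkt hα hg0 hY n (F := fun p => mixtureIncrement k fZ x p ^ 2)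
      (C := C ^ 2) ((measurable_mixtureIncrement hkt x).pow_const 2) fun g hg y => ?_
    rw [abs_pow]
    exact pow_le_pow_left₀ (abs_nonneg _) (abs_mixtureIncrement_le hkt hk hC hg y) 2

/-- The tail of the martingale after time `n` starts with `α (n + 1)`, while the normalising sums
start with `α n`. The difference `b n * α n ^ 2` tends to 0 by the condition on the supremum. -/
theorem localCLT_of_tendsto [IsProbabilityMeasure P] (hmodel : ModelAssumptions k fZ g0)
    (hα : LearningRate α) (hY : IsLearningProcess P k fZ g0 α Y) {g : Ω → Θ → ℝ}
    (hg : IsLimitMixing P (newton (noisyKernel k fZ) α g0 Y) g) (x : ℝ) {b : ℕ → ℝ}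
    (hb : ∀ n, 1 ≤ n → 0 ≤ b n)
    (hsup : Tendsto (fun n => b n * ⨆ j : ℕ, α (n + j) ^ 2) atTop (𝓝 0))
    (htail : Tendsto (fun n => b n * ∑' j : ℕ, α (n + j) ^ 2) atTop (𝓝 1)) :
    LocalCLT P k fZ g0 α Y g b x := by
  have hkt := hmodel.posDensities_noisyKernel
  have hg0 : g0 ∈ stdSimplex ℝ Θ := ⟨fun θ => (hmodel.g0_pos θ).le, hmodel.g0_sum⟩
  obtain ⟨C, hC⟩ := hmodel.k_bounded
  have hk : ∀ θ, 0 ≤ k θ x := fun θ => (hmodel.k_pos θ x).le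
  have hC' : ∀ θ, k θ x ≤ C := fun θ => hC θ x
  have hbe : ∀ᶠ n in atTop, 0 ≤ b n := eventually_atTop.2 ⟨1, hb⟩
  have hsum : ∀ n, Summable fun j => α (n + j) ^ 2 := fun n => by
    refine ((summable_nat_add_iff n).2 hα.sq_summable).congr fun j => by rw [add_comm]
  -- Boundedness of the squares, here from summability, is needed for the real supremum to be an
  -- upper bound.
  have hle : ∀ n j, α (n + j) ^ 2 ≤ ⨆ j : ℕ, α (n + j) ^ 2 := fun n =>
    le_ciSup (hsum n).tendsto_atTop_zero.bddAbove_range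
  have hfst : Tendsto (fun n => b n * α n ^ 2) atTop (𝓝 0) := by
    refine squeeze_zero' ?_ ?_ hsup
    · filter_upwards [hbe] with n hn using mul_nonneg hn (sq_nonneg _)
    · filter_upwards [hbe] with n hn using mul_le_mul_of_nonneg_left (hle n 0) hn
  have hsplit : ∀ n, b n * ∑' j : ℕ, α (n + j) ^ 2 - b n * α n ^ 2
      = b n * ∑' j : ℕ, α (n + j + 1) ^ 2 := fun n => by
    rw [(hsum n).tsum_eq_zero_add]
    simp only [add_zero, ← add_assoc]
    ring
  refine (boundedIncrements_mixture hkt hα hg0 hY hk hC').almostSureCondConvergence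
    hα.sq_summable (M' := fun ω => mixture k (g ω) x)
    (v' := fun ω => asympVariance k fZ (g ω) x) ?_ ((measurable_asympVariance hkt x).comp
      hg.measurable) ?_ ?_ hbe hsup ?_ ?_
  · have : Measurable fun g : Θ → ℝ => mixture k g x := by unfold mixture; fun_prop
    exact this.comp hg.measurable
  · filter_upwards [hg.tendsto] with ω hω using tendsto_mixture hω x
  · filter_upwards [hg.tendsto] with ω hω
    exact tendsto_asympVariance hkt hk hC' (hg.mem_simplex ω)
      (fun n => newton_mem_stdSimplex hkt hα hg0 n ω) hω
  · filter_upwards [hbe] with n hn j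
    exact mul_le_mul_of_nonneg_left (hle n (j + 1)) hn
  · have := htail.sub hfst
    rw [sub_zero] at this
    exact this.congr hsplit

end

/-! ### Power learning rates -/

/-- This is the mean value theorem for `y ↦ y ^ (1 - p)`; it compares `y ^ (-p)` with telescoping
differences. -/
theorem rpow_one_sub_sub_bounds {p s : ℝ} (hp : 1 < p) (hs : 0 < s) :
    (p - 1) * (s + 1) ^ (-p) ≤ s ^ (1 - p) - (s + 1) ^ (1 - p) ∧
      s ^ (1 - p) - (s + 1) ^ (1 - p) ≤ (p - 1) * s ^ (-p) := by
  obtain ⟨c, ⟨hc1, hc2⟩, hc⟩ := exists_hasDerivAt_eq_slope (fun y : ℝ => y ^ (1 - p))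
    (fun y => (1 - p) * y ^ (1 - p - 1)) (show s < s + 1 by linarith)
    (fun y hy => (Real.continuousAt_rpow_const _ _
      (Or.inl (hs.trans_le hy.1).ne')).continuousWithinAt)
    (fun y hy => Real.hasDerivAt_rpow_const (Or.inl (hs.trans hy.1).ne'))
  have hslope : s ^ (1 - p) - (s + 1) ^ (1 - p) = (p - 1) * c ^ (-p) := by
    rw [show (1 : ℝ) - p - 1 = -p by ring, add_sub_cancel_left, div_one] at hc
    linarith
  rw [hslope]
  have hc0 : 0 < c := hs.trans hc1
  exact ⟨mul_le_mul_of_nonneg_left (Real.rpow_le_rpow_of_nonpos hc0 hc2.le (by linarith))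
    (by linarith), mul_le_mul_of_nonneg_left
    (Real.rpow_le_rpow_of_nonpos hs hc1.le (by linarith)) (by linarith)⟩

theorem hasSum_rpow_one_sub_sub {p s : ℝ} (hp : 1 < p) (hs : 0 < s) :
    HasSum (fun j : ℕ => (s + j) ^ (1 - p) - (s + j + 1) ^ (1 - p)) (s ^ (1 - p)) := by
  have hpos : ∀ j : ℕ, 0 < s + j := fun j => by positivity
  refine (hasSum_iff_tendsto_nat_of_nonneg (fun j => ?_) _).2 ?_
  · exact le_trans (mul_nonneg (by linarith) (Real.rpow_nonneg (by linarith [hpos j]) _))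
      (rpow_one_sub_sub_bounds hp (hpos j)).1
  · have htel : ∀ N : ℕ, ∑ j ∈ Finset.range N, ((s + j) ^ (1 - p) - (s + j + 1) ^ (1 - p))
        = s ^ (1 - p) - (s + N) ^ (1 - p) := fun N => by
      have := Finset.sum_range_sub' (fun j : ℕ => (s + j) ^ (1 - p)) N
      simpa [add_assoc] using this
    simp_rw [htel]
    have h1 : Tendsto (fun N : ℕ => s + (N : ℝ)) atTop atTop :=
      tendsto_atTop_add_const_left _ _ tendsto_natCast_atTop_atTop
    have h2 := (tendsto_rpow_neg_atTop (show 0 < p - 1 by linarith)).comp h1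
    have h3 := h2.const_sub (s ^ (1 - p))
    rw [sub_zero] at h3
    refine h3.congr fun N => ?_
    simp [Function.comp]

theorem summable_add_rpow_neg {p s : ℝ} (hp : 1 < p) (hs : 0 < s) :
    Summable fun j : ℕ => (s + j) ^ (-p) := by
  rw [← summable_nat_add_iff 1]
  refine Summable.of_nonneg_of_le (fun j => by positivity) (fun j => ?_)
    ((hasSum_rpow_one_sub_sub hp hs).summable.mul_left (p - 1)⁻¹)
  have := (rpow_one_sub_sub_bounds hp (show 0 < s + j by positivity)).1
  rw [inv_mul_eq_div, le_div_iff₀ (by linarith), mul_comm]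
  simpa [add_assoc] using this

/-- Each term lies between telescoping differences over the unit intervals on its right and on its
left, so the two bounds start at `s + 1` and at `s`. -/
theorem tsum_add_rpow_neg_bounds {p s : ℝ} (hp : 1 < p) (hs : 0 < s) :
    (s + 1) ^ (1 - p) ≤ (p - 1) * ∑' j : ℕ, (s + 1 + j) ^ (-p) ∧
      (p - 1) * ∑' j : ℕ, (s + 1 + j) ^ (-p) ≤ s ^ (1 - p) := by
  have hs1 : 0 < s + 1 := by linarith
  have hsum := (summable_add_rpow_neg hp hs1).mul_left (p - 1)
  rw [← tsum_mul_left]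
  constructor
  · rw [← (hasSum_rpow_one_sub_sub hp hs1).tsum_eq]
    exact (hasSum_rpow_one_sub_sub hp hs1).summable.tsum_le_tsum
      (fun j => (rpow_one_sub_sub_bounds hp (by positivity)).2) hsum
  · rw [← (hasSum_rpow_one_sub_sub hp hs).tsum_eq]
    refine hsum.tsum_le_tsum (fun j => ?_) (hasSum_rpow_one_sub_sub hp hs).summable
    rw [add_right_comm]
    exact (rpow_one_sub_sub_bounds hp (by positivity)).1

theorem tendsto_natCast_rpow_mul_add_rpow (q s : ℝ) :
    Tendsto (fun n : ℕ => (n : ℝ) ^ q * (s + n) ^ (-q)) atTop (𝓝 1) := by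
  have h1 : Tendsto (fun n : ℕ => (s + n) / (n : ℝ)) atTop (𝓝 1) := by
    have h2 : Tendsto (fun n : ℕ => s / (n : ℝ) + 1) atTop (𝓝 (0 + 1)) :=
      (tendsto_const_div_atTop_nhds_zero_nat s).add_const 1
    rw [zero_add] at h2
    refine h2.congr' ?_
    filter_upwards [eventually_ge_atTop 1] with n hn
    have : (n : ℝ) ≠ 0 := by positivity
    field_simp
  have h3 := h1.rpow_const (p := -q) (Or.inl one_ne_zero)
  rw [Real.one_rpow] at h3
  refine h3.congr' ?_
  have h4 : ∀ᶠ n : ℕ in atTop, 0 ≤ s + (n : ℝ) :=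
    (tendsto_atTop_add_const_left _ s tendsto_natCast_atTop_atTop).eventually_ge_atTop 0
  filter_upwards [eventually_ge_atTop 1, h4] with n hn h5
  rw [Real.div_rpow h5 (Nat.cast_nonneg n), Real.rpow_neg (Nat.cast_nonneg n), div_inv_eq_mul,
    mul_comm]

theorem tendsto_natCast_rpow_mul_tsum {a p : ℝ} (ha : 0 < a) (hp : 1 < p) :
    Tendsto (fun n : ℕ => (n : ℝ) ^ (p - 1) * ((p - 1) * ∑' j : ℕ, (a + n + j) ^ (-p)))
      atTop (𝓝 1) := by
  have h1 := tendsto_natCast_rpow_mul_add_rpow (p - 1) a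
  -- The shift `a - 1` may be negative, but `a - 1 + n` is positive for `n ≥ 1`.
  have h2 := tendsto_natCast_rpow_mul_add_rpow (p - 1) (a - 1)
  have hb : ∀ n : ℕ, 1 ≤ n → (a + n) ^ (1 - p) ≤ (p - 1) * ∑' j : ℕ, (a + n + j) ^ (-p) ∧
      (p - 1) * ∑' j : ℕ, (a + n + j) ^ (-p) ≤ (a - 1 + n) ^ (1 - p) := fun n hn => by
    have hn' : (1 : ℝ) ≤ n := by exact_mod_cast hn
    have := tsum_add_rpow_neg_bounds hp (show 0 < a - 1 + n by linarith)
    rwa [show a - 1 + (n : ℝ) + 1 = a + n by ring] at this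
  rw [neg_sub] at h1 h2
  refine tendsto_of_tendsto_of_tendsto_of_le_of_le' h1 h2 ?_ ?_
  · filter_upwards [eventually_ge_atTop 1] with n hn
    exact mul_le_mul_of_nonneg_left (hb n hn).1 (by positivity)
  · filter_upwards [eventually_ge_atTop 1] with n hn
    exact mul_le_mul_of_nonneg_left (hb n hn).2 (by positivity)

theorem sq_rpow_learningRate {a γ y : ℝ} (ha : 0 < a) (hy : 0 ≤ y) :
    ((a / (a + y)) ^ γ) ^ 2 = a ^ (2 * γ) * (a + y) ^ (-(2 * γ)) := by
  have hay : 0 ≤ a + y := by linarith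
  rw [← Real.rpow_natCast, ← Real.rpow_mul (div_nonneg ha.le hay), Nat.cast_ofNat, mul_comm γ 2,
    Real.div_rpow ha.le hay, Real.rpow_neg hay, div_eq_mul_inv]

theorem tendsto_powerRate_tail {α : ℕ → ℝ} {a γ : ℝ} (ha : 0 < a) (hγ : 1 / 2 < γ)
    (hα : ∀ n : ℕ, 1 ≤ n → α n = (a / (a + n)) ^ γ) :
    Tendsto (fun n : ℕ => (2 * γ - 1) / a ^ (2 * γ) * (n : ℝ) ^ (2 * γ - 1) *
      ∑' j : ℕ, α (n + j) ^ 2) atTop (𝓝 1) := by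
  refine (tendsto_natCast_rpow_mul_tsum ha (show 1 < 2 * γ by linarith)).congr' ?_
  filter_upwards [eventually_ge_atTop 1] with n hn
  have : ∀ j : ℕ, α (n + j) ^ 2 = a ^ (2 * γ) * (a + n + j) ^ (-(2 * γ)) := fun j => by
    rw [hα _ (by omega), sq_rpow_learningRate ha (Nat.cast_nonneg _), Nat.cast_add, add_assoc]
  simp_rw [this]
  rw [tsum_mul_left]
  have : a ^ (2 * γ) ≠ 0 := (Real.rpow_pos_of_pos ha _).ne'
  field_simp

theorem tendsto_powerRate_sup {α : ℕ → ℝ} {a γ : ℝ} (ha : 0 < a) (hγ : 1 / 2 < γ)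
    (hα : ∀ n : ℕ, 1 ≤ n → α n = (a / (a + n)) ^ γ) :
    Tendsto (fun n : ℕ => (2 * γ - 1) / a ^ (2 * γ) * (n : ℝ) ^ (2 * γ - 1) *
      ⨆ j : ℕ, α (n + j) ^ 2) atTop (𝓝 0) := by
  have hg : 0 < 2 * γ - 1 := by linarith
  refine squeeze_zero' (Eventually.of_forall fun n => ?_) ?_
    (tendsto_const_div_atTop_nhds_zero_nat (2 * γ - 1))
  · exact mul_nonneg (by positivity) (Real.iSup_nonneg fun j => sq_nonneg _)
  filter_upwards [eventually_ge_atTop 1] with n hn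
  have hn0 : (0 : ℝ) < n := by exact_mod_cast hn
  -- Dropping `a` and `j` from the base leaves the right power of `n`: after multiplication by `b n`
  -- the bound is `(2 * γ - 1) / n`.
  have hsup : ⨆ j : ℕ, α (n + j) ^ 2 ≤ a ^ (2 * γ) * (n : ℝ) ^ (-(2 * γ)) := by
    refine ciSup_le fun j => ?_
    rw [hα _ (by omega), sq_rpow_learningRate ha (Nat.cast_nonneg _)]
    refine mul_le_mul_of_nonneg_left (Real.rpow_le_rpow_of_nonpos hn0 ?_ (by linarith))
      (by positivity)
    push_cast
    have : (0 : ℝ) ≤ j := Nat.cast_nonneg j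
    linarith
  refine (mul_le_mul_of_nonneg_left hsup (by positivity)).trans_eq ?_
  have hpow : (n : ℝ) ^ (2 * γ - 1) * (n : ℝ) ^ (-(2 * γ)) = (n : ℝ)⁻¹ := by
    rw [← Real.rpow_add hn0, show 2 * γ - 1 + -(2 * γ) = -1 by ring, Real.rpow_neg_one]
  have ha0 : a ^ (2 * γ) ≠ 0 := (Real.rpow_pos_of_pos ha _).ne'
  calc _ = (2 * γ - 1) * ((n : ℝ) ^ (2 * γ - 1) * (n : ℝ) ^ (-(2 * γ)))
        * (a ^ (2 * γ) / a ^ (2 * γ)) := by ring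
    _ = _ := by rw [hpow, div_self ha0, mul_one, div_eq_mul_inv]

end NewtonDeconvolution

theorem theorem3 {Θ Ω : Type*} [Fintype Θ] [MeasurableSpace Ω]
    (P : Measure Ω) [IsProbabilityMeasure P]
    (k : Θ → ℝ → ℝ) (fZ : ℝ → ℝ) (g0 : Θ → ℝ) (α : ℕ → ℝ) (Y : ℕ → Ω → ℝ)
    (hmodel : ModelAssumptions k fZ g0) (hα : LearningRate α)
    (hY : IsLearningProcess P k fZ g0 α Y) :
    (∃ g : Ω → Θ → ℝ, IsLimitMixing P (newton (noisyKernel k fZ) α g0 Y) g) ∧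
    ∀ g : Ω → Θ → ℝ, IsLimitMixing P (newton (noisyKernel k fZ) α g0 Y) g →
      ∀ x : ℝ,
        (∀ b : ℕ → ℝ, NormalisingSequence α b → LocalCLT P k fZ g0 α Y g b x) ∧
        (∀ a γ : ℝ, 0 < a → 1 / 2 < γ → γ ≤ 1 →
          (∀ n : ℕ, 1 ≤ n → α n = (a / (a + n)) ^ γ) →
            LocalCLT P k fZ g0 α Y g
              (fun n => (2 * γ - 1) / a ^ (2 * γ) * (n : ℝ) ^ (2 * γ - 1)) x) := by
  have hkt := hmodel.posDensities_noisyKernel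
  have hg0 : g0 ∈ stdSimplex ℝ Θ := ⟨fun θ => (hmodel.g0_pos θ).le, hmodel.g0_sum⟩
  refine ⟨exists_isLimitMixing hkt hα hg0 hY, fun g hg x => ⟨fun b hb => ?_, ?_⟩⟩
  · exact localCLT_of_tendsto hmodel hα hY hg x (fun n hn => (hb.pos n hn).le) hb.sup_tendsto
      hb.tail_tendsto
  · intro a γ ha hγ _ hαn
    have hγ' : 0 < 2 * γ - 1 := by linarith
    exact localCLT_of_tendsto hmodel hα hY hg x (fun n _ => by positivity)
      (tendsto_powerRate_sup ha hγ hαn) (tendsto_powerRate_tail ha hγ hαn)
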